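/- Let $n\ge 1$, let $\mathbb C^{+n}=\{z\in\mathbb C^n:\operatorname{Im} z_j>0\ \forall j\}$, and let $K_n\colon(\mathbb C\setminus\mathbb R)^n\times\mathbb R^n\to\mathbb C$ be the kernel $$K_n(z,t)=i\left(\frac{2}{(2i)^n}\prod_{\ell=1}^n\Big(\frac1{t_\ell-z_\ell}-\frac1{t_\ell+i}\Big)-\frac1{(2i)^n}\prod_{\ell=1}^n\Big(\frac1{t_\ell-i}-\frac1{t_\ell+i}\Big)\right).$$ A Herglotz–Nevanlinna function is a holomorphic function $h\colon\mathbb C^{+n}\to\mathbb C$ with $\operatorname{Im}h\ge 0$. Such an $h$ has a unique representation $$h(z)=a+\sum_{j=1}^n b_jz_j+\frac1{\pi^n}\int_{\mathbb R^n}K_n(z,t)\,d\mu(t)\qquad(z\in\mathbb C^{+n}),\tag{1}$$ where $a\in\mathbb R$, $b\in[0,\infty)^n$, and $\mu$ is a positive Borel measure on $\mathbb R^n$ with $\int\prod_{\ell}(1+t_\ell^2)^{-1}\,d\mu(t)<\infty$ and $$\sum_{\rho}\int_{\mathbb R^n}\prod_{j=1}^nN_{\rho_j}(z_j,t_j)\,d\mu(t)=0\qquad\text{for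 all }z\in\mathbb C^{+n},$$ the sum being over all $\rho\in\{-1,0,1\}^n$ in which both $-1$ and $1$ occur, where $N_{-1}(z,t)=\frac1{2i}\big(\frac1{t-z}-\frac1{t-i}\big)$, $N_0(z,t)=\frac1{2i}\big(\frac1{t-i}-\frac1{t+i}\big)$, $N_1(z,t)=\frac1{2i}\big(\frac1{t+i}-\frac1{t-\bar z}\big)$. The symmetric extension $h_{\mathrm{sym}}\colon(\mathbb C\setminus\mathbb R)^n\to\mathbb C$ of $h$ is the function given by the right-hand side of (1) for all $z\in(\mathbb C\setminus\mathbb R)^n$. Let $f\colon(\mathbb C\setminus\mathbb R)^n\to\mathbb C$ be holomorphic, and let $d_1,\dots,d_n\ge 0$ be such that for every $j$ and every choice of the variables $z_k\in\mathbb C\setminus\mathbb R$, $k\neq j$, one has $f(z)/z_j\to d_j$ as $|z_j|\to\infty$ within each upper Stoltz domain $\{w:\operatorname{Im}w>0,\ \theta\le\arg w\le\pi-\theta\}$ and within each lower Stoltz domain $\{w:\bar w\text{ lies in the upper one}\}$, $\theta\in(0,\frac\pi2]$. Put $g(z)=f(z)-\sum_{j=1}^nd_jz_j$. Then $f=h_{\mathrm{sym}}$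 for some Herglotz–Nevanlinna function $h$ if and only if the following three conditions hold: (i) $\operatorname{Im}f(z)\ge0$ for all $z\in\mathbb C^{+n}$; (ii') $g$ satisfies the symmetry formula $$g(z)=\sum_{\emptyset\ne B\subseteq\{1,\dots,n\}}(-1)^{|B|+1}\,\overline{g(\Psi_B(z))}\qquad\text{for all }z\in(\mathbb C\setminus\mathbb R)^n,$$ where $\Psi_B(z)$ has $j$-th component $\overline{z_j}$ if $j\in B$ and $i$ if $j\notin B$; (iii') $g$ satisfies the variable non-dependence property: whenever $z\in(\mathbb C\setminus\mathbb R)^n$ has at least one component with negative imaginary part, the value $g(z)$ does not change when the components of $z$ lying in the upper half-plane are replaced by arbitrary other points of the upper half-plane. -/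

import Mathlib

open scoped ComplexConjugate Topology

noncomputable section

namespace HerglotzNevanlinna

/-- The poly-upper half-plane `(ℂ⁺)ⁿ`. -/
def polyUpper (n : ℕ) : Set (Fin n → ℂ) := {z | ∀ j, 0 < (z j).im}

/-- The poly cut-plane `(ℂ ∖ ℝ)ⁿ`. -/
def polyCut (n : ℕ) : Set (Fin n → ℂ) := {z | ∀ j, (z j).im ≠ 0}

/-- The upper Stoltz domain with centre `0` and angle `θ`. -/
def upperStoltz (θ : ℝ) : Set ℂ :=
  {z | 0 < z.im ∧ θ ≤ z.arg ∧ z.arg ≤ Real.pi - θ}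

/-- The lower Stoltz domain with centre `0` and angle `θ` (the mirror image of the upper one). -/
def lowerStoltz (θ : ℝ) : Set ℂ :=
  {z | z.im < 0 ∧ -(Real.pi - θ) ≤ z.arg ∧ z.arg ≤ -θ}

/-- `φ w → l` as `|w| → ∞` in any upper Stoltz domain. -/
def TendstoUpper (φ : ℂ → ℂ) (l : ℂ) : Prop :=
  ∀ θ : ℝ, 0 < θ → θ ≤ Real.pi / 2 →
    Filter.Tendsto φ (Bornology.cobounded ℂ ⊓ Filter.principal (upperStoltz θ)) (𝓝 l)

/-- `φ w → l` as `|w| → ∞` in any lower Stoltz domain. -/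
def TendstoLower (φ : ℂ → ℂ) (l : ℂ) : Prop :=
  ∀ θ : ℝ, 0 < θ → θ ≤ Real.pi / 2 →
    Filter.Tendsto φ (Bornology.cobounded ℂ ⊓ Filter.principal (lowerStoltz θ)) (𝓝 l)

/-- The kernel `K_n`. -/
def kernel {n : ℕ} (z : Fin n → ℂ) (t : Fin n → ℝ) : ℂ :=
  Complex.I *
    (2 / (2 * Complex.I) ^ n * ∏ l, (1 / ((t l : ℂ) - z l) - 1 / ((t l : ℂ) + Complex.I))
      - 1 / (2 * Complex.I) ^ n *
        ∏ l, (1 / ((t l : ℂ) - Complex.I) - 1 / ((t l : ℂ) + Complex.I)))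

/-- The factors `N_{-1}`, `N_0`, `N_1`. -/
def nFactor : SignType → ℂ → ℝ → ℂ
  | SignType.neg, z, t => 1 / (2 * Complex.I) * (1 / ((t : ℂ) - z) - 1 / ((t : ℂ) - Complex.I))
  | SignType.zero, _, t =>
      1 / (2 * Complex.I) * (1 / ((t : ℂ) - Complex.I) - 1 / ((t : ℂ) + Complex.I))
  | SignType.pos, z, t =>
      1 / (2 * Complex.I) * (1 / ((t : ℂ) + Complex.I) - 1 / ((t : ℂ) - conj z))

/-- The growth condition `∫ ∏ 1 / (1 + t_l²) dμ(t) < ∞`. -/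
def GrowthCondition {n : ℕ} (μ : MeasureTheory.Measure (Fin n → ℝ)) : Prop :=
  ∫⁻ t, ENNReal.ofReal (∏ l, 1 / (1 + t l ^ 2)) ∂μ < ⊤

/-- The Nevanlinna condition; the sum is over all `ρ ∈ {-1, 0, 1}ⁿ` in which both `-1` and `1`
occur. -/
def NevanlinnaCondition {n : ℕ} (μ : MeasureTheory.Measure (Fin n → ℝ)) : Prop :=
  ∀ z ∈ polyUpper n,
    ∑ ρ : Fin n → SignType with (∃ j, ρ j = -1) ∧ (∃ j, ρ j = 1),
      ∫ t, ∏ j, nFactor (ρ j) (z j) (t j) ∂μ = 0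

/-- `a + ∑ b_j z_j + π⁻ⁿ ∫ K_n(z, t) dμ(t)`. -/
def integralFormula {n : ℕ} (a : ℝ) (b : Fin n → ℝ) (μ : MeasureTheory.Measure (Fin n → ℝ))
    (z : Fin n → ℂ) : ℂ :=
  (a : ℂ) + ∑ j, (b j : ℂ) * z j + 1 / (Real.pi : ℂ) ^ n * ∫ t, kernel z t ∂μ

/-- Herglotz–Nevanlinna functions: holomorphic on `(ℂ⁺)ⁿ`, with non-negative imaginary part. -/
def IsHerglotzNevanlinna {n : ℕ} (h : (Fin n → ℂ) → ℂ) : Prop :=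
  DifferentiableOn ℂ h (polyUpper n) ∧ ∀ z ∈ polyUpper n, 0 ≤ (h z).im

/-- `(a, b, μ)` are representing parameters of `h` on `(ℂ⁺)ⁿ`. -/
structure Represents {n : ℕ} (a : ℝ) (b : Fin n → ℝ) (μ : MeasureTheory.Measure (Fin n → ℝ))
    (h : (Fin n → ℂ) → ℂ) : Prop where
  nonneg : ∀ j, 0 ≤ b j
  growth : GrowthCondition μ
  nevanlinna : NevanlinnaCondition μ
  eq : ∀ z ∈ polyUpper n, h z = integralFormula a b μ z

/-- `f = h_sym` on `(ℂ ∖ ℝ)ⁿ`: the function `f` is given there by the integral formula with the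
representing parameters of `h`. -/
def IsSymmetricExtension {n : ℕ} (h f : (Fin n → ℂ) → ℂ) : Prop :=
  ∃ (a : ℝ) (b : Fin n → ℝ) (μ : MeasureTheory.Measure (Fin n → ℝ)),
    Represents a b μ h ∧ ∀ z ∈ polyCut n, f z = integralFormula a b μ z

/-- The selective conjugation map: the components of `z` in `B` are replaced by the conjugates of
those of `w`. -/
def selConj {n : ℕ} (B : Finset (Fin n)) (z w : Fin n → ℂ) : Fin n → ℂ :=
  fun j => if j ∈ B then conj (w j) else z j

/-- The symmetry formula on `(ℂ ∖ ℝ)ⁿ`. -/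
def SymmetryFormula {n : ℕ} (g : (Fin n → ℂ) → ℂ) : Prop :=
  ∀ z ∈ polyCut n,
    g z = ∑ B : Finset (Fin n) with B.Nonempty,
      (-1 : ℂ) ^ (B.card + 1) * conj (g (selConj B (fun _ => Complex.I) z))

/-- The variable non-dependence property: if some component of `z` lies in `ℂ⁻`, then the value
at `z` is unchanged when the components in `ℂ⁺` are moved within `ℂ⁺`, the components in `ℂ⁻`
being kept. -/
def VariableNonDependence {n : ℕ} (g : (Fin n → ℂ) → ℂ) : Prop :=
  ∀ z ∈ polyCut n, ∀ w ∈ polyCut n, (∃ j, (z j).im < 0) →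
    (∀ j, (z j).im < 0 → w j = z j) → (∀ j, 0 < (z j).im → 0 < (w j).im) → g z = g w

end HerglotzNevanlinna

end

/-!
# Symmetric extensions of Herglotz–Nevanlinna functions

If `f` is a symmetric extension with representing parameters `(a, b, μ)`, dominated convergence
along the imaginary axes gives `b = d`, so `g` is the integral term `a + π⁻ⁿ ∫ Kₙ(z, t) dμ(t)`.
The kernel is `i (2 ∏ uₗ - ∏ cₗ)` with `cₗ = 1 / (1 + tₗ²)` and factors `uₗ` (`halfPlaneFactor`)
satisfying `conj (u (conj z)) = c - u z`; expanding `∏ (c - (c - u))` over subsets shows that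
the kernel satisfies the symmetry formula pointwise in `t` (`kernel_symmetry`). For the
non-dependence property, `u = N₀ + N₋₁` in the upper and `u = -N₁` in the lower half-plane, so the
dependence on the upper variables is through integrals of products of the factors `N` of mixed
sign. The Nevanlinna condition says that the sum of all of these vanishes; since the summands are
holomorphic, constant or antiholomorphic in each variable according to the sign, each of them
vanishes (`nIntegral_eq_zero`).

Conversely, a Schwarz–Pick argument in one variable at a time shows that `g = f - ∑ dⱼ zⱼ` still
has non-negative imaginary part (`im_sub_linear_nonneg`). The Cayley transform takes `g` to
a function with non-negative real part on the polydisc, which has a Herglotz representation by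
a measure on the torus whose moments of mixed sign vanish (`exists_torus_measure`): a weak limit of
the measures `Re F(rτ) dm(τ)`, for which the representation is Cauchy's formula. As `g` grows
sublinearly in every variable, this measure has no mass at infinity, so it can be carried to `ℝⁿ`,
which represents `g` on the poly-upper half-plane (`exists_represents`). Finally `g` and
its integral formula both have the symmetry and non-dependence properties, and such functions are
determined by their values on the poly-upper half-plane (`eq_zero_of_symmetry`).
-/

noncomputable section

namespace HerglotzNevanlinna

open MeasureTheory Metric Set Filter

variable {n : ℕ}

/-! ### The torus and Cauchy's formula on it -/

/-- The unit circle, as a subtype of `ℂ`; it carries the subspace topology and the induced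
Borel `σ`-algebra. -/
abbrev UnitCircle : Type := sphere (0 : ℂ) 1

/-- The parametrization `θ ↦ exp (i θ)` of the unit circle. -/
def circleParam (θ : ℝ) : UnitCircle := ⟨circleMap 0 1 θ, by simp⟩

lemma continuous_circleParam : Continuous circleParam :=
  (continuous_circleMap 0 1).subtype_mk _

/-- Normalized arc length on the unit circle. -/
def arcMeasure : Measure UnitCircle :=
  (ENNReal.ofReal (2 * Real.pi)⁻¹ • volume.restrict (Ioc 0 (2 * Real.pi))).map circleParam

instance : IsProbabilityMeasure arcMeasure := by
  refine (Measure.isProbabilityMeasure_map_iff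
    continuous_circleParam.measurable.aemeasurable).2 ⟨?_⟩
  simp only [Measure.smul_apply, Measure.restrict_apply MeasurableSet.univ, univ_inter,
    Real.volume_Ioc, sub_zero, smul_eq_mul]
  rw [← ENNReal.ofReal_mul (by positivity), inv_mul_cancel₀ (by positivity), ENNReal.ofReal_one]

lemma integral_arcMeasure (f : ℂ → ℂ) (hf : Continuous fun s : UnitCircle => f s) :
    ∫ s : UnitCircle, f s ∂arcMeasure = Real.circleAverage f 0 1 := by
  rw [arcMeasure, integral_map continuous_circleParam.measurable.aemeasurable
    hf.aestronglyMeasurable, integral_smul_measure, Real.circleAverage_def,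
    intervalIntegral.integral_of_le (by positivity), ENNReal.toReal_ofReal (by positivity)]
  rfl

/-- The Cauchy kernel of the unit disc, as a function of `ζ` in the disc and `w` on the circle. -/
def cauchyKernel (ζ w : ℂ) : ℂ := (1 - ζ * conj w)⁻¹

@[simp] lemma cauchyKernel_zero (w : ℂ) : cauchyKernel 0 w = 1 := by simp [cauchyKernel]

lemma one_sub_mul_conj_ne_zero {ζ w : ℂ} (hζ : ‖ζ‖ < 1) (hw : ‖w‖ ≤ 1) : 1 - ζ * conj w ≠ 0 := by
  intro h
  have h1 : ‖ζ * conj w‖ = 1 := by rw [← sub_eq_zero.1 h, norm_one]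
  rw [norm_mul, RCLike.norm_conj] at h1
  nlinarith [norm_nonneg ζ, norm_nonneg w]

lemma continuousOn_cauchyKernel {ζ : ℂ} (hζ : ‖ζ‖ < 1) :
    ContinuousOn (cauchyKernel ζ) (closedBall 0 1) := by
  refine ContinuousOn.inv₀ (by fun_prop) fun w hw => one_sub_mul_conj_ne_zero hζ (by simpa using hw)

lemma continuous_cauchyKernel_circle {ζ : ℂ} (hζ : ‖ζ‖ < 1) :
    Continuous fun s : UnitCircle => cauchyKernel ζ s :=
  (continuousOn_cauchyKernel hζ).comp_continuous continuous_subtype_val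
    fun s => sphere_subset_closedBall s.2

/-- Cauchy's formula on the unit disc. -/
lemma integral_mul_cauchyKernel {q : ℂ → ℂ} (hq : DiffContOnCl ℂ q (ball 0 1)) {ζ : ℂ}
    (hζ : ‖ζ‖ < 1) : ∫ s : UnitCircle, q s * cauchyKernel ζ s ∂arcMeasure = q ζ := by
  have hqc : ContinuousOn q (closedBall 0 1) := by
    simpa [closure_ball (0 : ℂ) one_ne_zero] using hq.2
  rw [integral_arcMeasure (fun w => q w * cauchyKernel ζ w)
    ((hqc.comp_continuous continuous_subtype_val fun s => sphere_subset_closedBall s.2).mul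
      (continuous_cauchyKernel_circle hζ))]
  rw [← DiffContOnCl.circleAverage_smul_div (f := q) (w := ζ) (c := 0) (R := 1)
    (by simpa using hq) (by simpa using hζ)]
  refine Real.circleAverage_congr_sphere fun w hw => ?_
  have hw1 : ‖w‖ = 1 := by simpa using hw
  have hw0 : w ≠ 0 := by rintro rfl; simp at hw1
  have hww : w * conj w = 1 := by
    rw [Complex.mul_conj, Complex.normSq_eq_norm_sq, hw1]; simp
  have h1 := one_sub_mul_conj_ne_zero hζ hw1.le
  have h2 : w - ζ = w * (1 - ζ * conj w) := by linear_combination ζ * hww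
  simp only [sub_zero, smul_eq_mul, cauchyKernel, h2]
  field_simp

/-- Normalized Haar measure on the `n`-dimensional torus. -/
def torusMeasure (n : ℕ) : Measure (Fin n → UnitCircle) := Measure.pi fun _ => arcMeasure

instance : IsProbabilityMeasure (torusMeasure n) := by unfold torusMeasure; infer_instance

/-- Resampling one coordinate of a uniformly distributed point of the torus does not change its
distribution. -/
lemma measurePreserving_update (j : Fin n) :
    MeasurePreserving (fun p : (Fin n → UnitCircle) × UnitCircle => Function.update p.1 j p.2)
      ((torusMeasure n).prod arcMeasure) (torusMeasure n) := by
  have hm : Measurable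
      (fun p : (Fin n → UnitCircle) × UnitCircle => Function.update p.1 j p.2) := by
    refine measurable_pi_lambda _ fun k => ?_
    by_cases hk : k = j
    · subst hk; simpa using measurable_snd
    · simp only [Function.update_of_ne hk]
      exact (measurable_pi_apply k).comp measurable_fst
  refine ⟨hm, ?_⟩
  refine (Measure.pi_eq fun s hs => ?_).symm
  rw [Measure.map_apply hm (MeasurableSet.univ_pi hs)]
  have : (fun p : (Fin n → UnitCircle) × UnitCircle => Function.update p.1 j p.2) ⁻¹' pi univ s
      = pi univ (Function.update s j univ) ×ˢ s j := by
    ext p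
    simp only [mem_preimage, Set.mem_pi, mem_univ, forall_const, mem_prod]
    constructor
    · intro h
      refine ⟨fun k => ?_, by simpa using h j⟩
      by_cases hk : k = j
      · subst hk; simp
      · simpa [Function.update_of_ne hk] using h k
    · rintro ⟨h1, h2⟩ k
      by_cases hk : k = j
      · subst hk; simpa using h2
      · simpa [Function.update_of_ne hk] using h1 k
  rw [this, Measure.prod_prod, torusMeasure, Measure.pi_pi,
    ← Finset.prod_erase_mul _ _ (Finset.mem_univ j),
    ← Finset.prod_erase_mul _ (fun i => arcMeasure (s i)) (Finset.mem_univ j)]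
  simp only [Function.update_self, measure_univ, mul_one]
  congr 1
  refine Finset.prod_congr rfl fun k hk => ?_
  rw [Function.update_of_ne (Finset.ne_of_mem_erase hk)]

lemma integrable_of_continuous_torus {E : Type*} [NormedAddCommGroup E]
    {ν : Measure (Fin n → UnitCircle)}
    [IsFiniteMeasure ν] {G : (Fin n → UnitCircle) → E} (hG : Continuous G) :
    Integrable G ν := by
  obtain ⟨C, hC⟩ := isCompact_univ.exists_bound_of_continuousOn hG.continuousOn
  exact Integrable.of_bound hG.aestronglyMeasurable C (.of_forall fun x => hC x (mem_univ x))

lemma integral_torus_update (j : Fin n) {G : (Fin n → UnitCircle) → ℂ} (hG : Continuous G) :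
    ∫ τ, G τ ∂torusMeasure n =
      ∫ τ, ∫ s, G (Function.update τ j s) ∂arcMeasure ∂torusMeasure n := by
  have h := measurePreserving_update (n := n) j
  rw [← h.map_eq, integral_map h.measurable.aemeasurable hG.aestronglyMeasurable, integral_prod,
    h.map_eq]
  exact h.integrable_comp_of_integrable (integrable_of_continuous_torus hG)

/-- The point of `ℂⁿ` underlying a point of the torus. -/
def torusCoe (τ : Fin n → UnitCircle) : Fin n → ℂ := fun j => τ j

lemma continuous_torusCoe : Continuous (torusCoe (n := n)) := by unfold torusCoe; fun_prop

lemma norm_torusCoe (τ : Fin n → UnitCircle) (j : Fin n) : ‖torusCoe τ j‖ = 1 := by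
  exact mem_sphere_zero_iff_norm.1 (τ j).2

lemma torusCoe_update (τ : Fin n → UnitCircle) (j : Fin n) (s : UnitCircle) :
    torusCoe (Function.update τ j s) = Function.update (torusCoe τ) j (s : ℂ) := by
  ext k
  by_cases hk : k = j
  · subst hk; simp [torusCoe]
  · simp [torusCoe, Function.update_of_ne hk]

/-- The closed unit polydisc. -/
def closedPolydisc (n : ℕ) : Set (Fin n → ℂ) := {w | ∀ j, ‖w j‖ ≤ 1}

lemma torusCoe_mem (τ : Fin n → UnitCircle) : torusCoe τ ∈ closedPolydisc n :=
  fun j => (norm_torusCoe τ j).le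

/-- Cauchy's formula in one of the coordinates of the torus. -/
lemma integral_torus_mul_cauchyKernel (j : Fin n) {G : (Fin n → ℂ) → ℂ}
    (hG : ContinuousOn G (closedPolydisc n))
    (hd : ∀ w ∈ closedPolydisc n, DiffContOnCl ℂ (fun x => G (Function.update w j x)) (ball 0 1))
    {ζ : ℂ} (hζ : ‖ζ‖ < 1) :
    ∫ τ, G (torusCoe τ) * cauchyKernel ζ (torusCoe τ j) ∂torusMeasure n =
      ∫ τ, G (Function.update (torusCoe τ) j ζ) ∂torusMeasure n := by
  rw [integral_torus_update j]
  · refine integral_congr_ae (.of_forall fun τ => ?_)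
    simp only [torusCoe_update, Function.update_self]
    exact integral_mul_cauchyKernel (hd _ (torusCoe_mem τ)) hζ
  · exact (hG.comp_continuous continuous_torusCoe torusCoe_mem).mul
      ((continuous_cauchyKernel_circle hζ).comp (continuous_apply j))

lemma integral_torus_eq_update_zero (j : Fin n) {G : (Fin n → ℂ) → ℂ}
    (hG : ContinuousOn G (closedPolydisc n))
    (hd : ∀ w ∈ closedPolydisc n, DiffContOnCl ℂ (fun x => G (Function.update w j x)) (ball 0 1)) :
    ∫ τ, G (torusCoe τ) ∂torusMeasure n =
      ∫ τ, G (Function.update (torusCoe τ) j 0) ∂torusMeasure n := by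
  simpa using integral_torus_mul_cauchyKernel j hG hd (ζ := 0) (by simp)

lemma update_mem_closedPolydisc {w : Fin n → ℂ} (hw : w ∈ closedPolydisc n) (j : Fin n) {x : ℂ}
    (hx : ‖x‖ ≤ 1) : Function.update w j x ∈ closedPolydisc n := by
  intro k
  by_cases hk : k = j
  · subst hk; simpa using hx
  · simpa [Function.update_of_ne hk] using hw k

/-- A function that is holomorphic near the closed polydisc is, in each coordinate, holomorphic on
the disc and continuous up to its boundary. -/
lemma diffContOnCl_update {F : (Fin n → ℂ) → ℂ}
    (hF : ∀ w ∈ closedPolydisc n, DifferentiableAt ℂ F w) (j : Fin n) {w : Fin n → ℂ}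
    (hw : w ∈ closedPolydisc n) :
    DiffContOnCl ℂ (fun x => F (Function.update w j x)) (ball 0 1) := by
  refine DifferentiableOn.diffContOnCl fun x hx => ?_
  rw [closure_ball (0 : ℂ) one_ne_zero] at hx
  exact ((hF _ (update_mem_closedPolydisc hw j (by simpa using hx))).comp x
    (hasFDerivAt_update w x).differentiableAt).differentiableWithinAt

/-- Cauchy's formula for the polydisc. -/
lemma cauchy_torus {F : (Fin n → ℂ) → ℂ}
    (hF : ∀ w ∈ closedPolydisc n, DifferentiableAt ℂ F w) {ζ : Fin n → ℂ} (hζ : ∀ j, ‖ζ j‖ < 1) :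
    ∫ τ, F (torusCoe τ) * ∏ j, cauchyKernel (ζ j) (torusCoe τ j) ∂torusMeasure n = F ζ := by
  have hFc : ContinuousOn F (closedPolydisc n) := fun w hw =>
    (hF w hw).continuousAt.continuousWithinAt
  -- the coordinates in `S` are replaced by those of `ζ`, one at a time
  have key : ∀ S : Finset (Fin n),
      ∫ τ, F (torusCoe τ) * ∏ j, cauchyKernel (ζ j) (torusCoe τ j) ∂torusMeasure n =
        ∫ τ, F (S.piecewise ζ (torusCoe τ)) * ∏ j ∈ Sᶜ, cauchyKernel (ζ j) (torusCoe τ j)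
          ∂torusMeasure n := by
    intro S
    induction S using Finset.induction_on with
    | empty => simp
    | insert j S hj ih =>
      rw [ih]
      have hpw : ∀ w ∈ closedPolydisc n, S.piecewise ζ w ∈ closedPolydisc n := by
        intro w hw k
        by_cases hk : k ∈ S
        · simpa [hk] using (hζ k).le
        · simpa [hk] using hw k
      have hcomp : Sᶜ = insert j (insert j S)ᶜ := by
        ext k; by_cases hk : k = j <;> simp [hk, hj]
      have hcont : ContinuousOn (fun w : Fin n → ℂ => F (S.piecewise ζ w) *
          ∏ k ∈ (insert j S)ᶜ, cauchyKernel (ζ k) (w k)) (closedPolydisc n) := by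
        refine (hFc.comp ?_ hpw).mul (continuousOn_finsetProd _ fun k _ => ?_)
        · refine (continuous_pi fun k => ?_).continuousOn
          by_cases hk : k ∈ S <;> simp [Finset.piecewise, hk] <;> fun_prop
        · exact (continuousOn_cauchyKernel (hζ k)).comp (by fun_prop)
            fun w hw => by simpa using hw k
      have hupd : ∀ (w : Fin n → ℂ) (x : ℂ), S.piecewise ζ (Function.update w j x) =
          Function.update (S.piecewise ζ w) j x := by
        intro w x
        ext k
        by_cases hk : k = j
        · subst hk; simp [hj]
        · by_cases hkS : k ∈ S <;> simp [hk, hkS]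
      have hprod : ∀ (w : Fin n → ℂ) (x : ℂ),
          ∏ k ∈ (insert j S)ᶜ, cauchyKernel (ζ k) (Function.update w j x k) =
          ∏ k ∈ (insert j S)ᶜ, cauchyKernel (ζ k) (w k) := by
        intro w x
        refine Finset.prod_congr rfl fun k hk => ?_
        have : k ≠ j := by rintro rfl; simp at hk
        simp [this]
      have := integral_torus_mul_cauchyKernel j hcont (fun w hw => by
        simp only [hupd, hprod]
        exact (diffContOnCl_update hF j (hpw w hw)).smul diffContOnCl_const) (hζ j)
      simp only [hupd, hprod] at this
      have e : ∀ w : Fin n → ℂ, Function.update (S.piecewise ζ w) j (ζ j) =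
          (insert j S).piecewise ζ w := by
        intro w; rw [Finset.piecewise_insert]
      simp only [e] at this
      rw [← this]
      refine integral_congr_ae (.of_forall fun τ => ?_)
      simp only [hcomp]
      rw [Finset.prod_insert (by simp)]
      ring
  rw [key Finset.univ]
  simp

/-! ### The Herglotz representation on the polydisc -/

/-- The factors `N_{-1}, N_0, N_1`, divided by `N_0`, in the coordinates of the disc and the
circle. -/
def torusFactor : SignType → ℂ → ℂ → ℂ
  | SignType.neg, ζ, w => cauchyKernel ζ w - 1
  | SignType.zero, _, _ => 1
  | SignType.pos, ζ, w => conj (cauchyKernel ζ w - 1)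

lemma conj_torusFactor (σ : SignType) (ζ w : ℂ) :
    conj (torusFactor σ ζ w) = torusFactor (-σ) ζ w := by
  cases σ
  · exact map_one _
  · rfl
  · exact Complex.conj_conj _

lemma conj_cauchyKernel (ζ w : ℂ) : conj (cauchyKernel ζ w) = (1 - conj ζ * w)⁻¹ := by
  simp [cauchyKernel]

lemma one_sub_conj_mul_ne_zero {ζ w : ℂ} (hζ : ‖ζ‖ < 1) (hw : ‖w‖ ≤ 1) : 1 - conj ζ * w ≠ 0 := by
  simpa using one_sub_mul_conj_ne_zero (ζ := conj ζ) (w := conj w) (by simpa) (by simpa)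

lemma continuousOn_torusFactor (σ : SignType) {ζ : ℂ} (hζ : ‖ζ‖ < 1) :
    ContinuousOn (torusFactor σ ζ) (closedBall 0 1) := by
  have h := (continuousOn_cauchyKernel hζ).sub (continuousOn_const (c := (1 : ℂ)))
  cases σ
  · exact continuousOn_const
  · exact h
  · exact Complex.continuous_conj.comp_continuousOn h

lemma continuous_torus_cauchyKernel {ζ : ℂ} (hζ : ‖ζ‖ < 1) (j : Fin n) :
    Continuous fun τ : Fin n → UnitCircle => cauchyKernel ζ (torusCoe τ j) :=
  (continuous_cauchyKernel_circle hζ).comp (continuous_apply j)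

lemma continuous_torus_torusFactor (σ : SignType) {ζ : ℂ} (hζ : ‖ζ‖ < 1) (j : Fin n) :
    Continuous fun τ : Fin n → UnitCircle => torusFactor σ ζ (torusCoe τ j) :=
  (continuousOn_torusFactor σ hζ).comp_continuous
    ((continuous_apply j).comp continuous_torusCoe) fun τ => by simpa using torusCoe_mem τ j

/-- If some index is `1`, the product of the factors is orthogonal to the conjugates of holomorphic
functions: it is holomorphic in the corresponding coordinate, and vanishes at its origin. -/
lemma integral_mul_prod_torusFactor {F : (Fin n → ℂ) → ℂ}
    (hF : ∀ w ∈ closedPolydisc n, DifferentiableAt ℂ F w) {ζ : Fin n → ℂ} (hζ : ∀ j, ‖ζ j‖ < 1)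
    {ρ : Fin n → SignType} {j : Fin n} (hj : ρ j = 1) :
    ∫ τ, F (torusCoe τ) * ∏ k, torusFactor (ρ k) (ζ k) (torusCoe τ k) ∂torusMeasure n = 0 := by
  have hFc : ContinuousOn F (closedPolydisc n) := fun w hw =>
    (hF w hw).continuousAt.continuousWithinAt
  have hj' : ρ j = SignType.pos := hj
  have hcont : ContinuousOn (fun w : Fin n → ℂ => F w *
      ∏ k, torusFactor (ρ k) (ζ k) (w k)) (closedPolydisc n) := by
    refine hFc.mul (continuousOn_finsetProd _ fun k _ => ?_)
    exact (continuousOn_torusFactor (ρ k) (hζ k)).comp (by fun_prop) fun w hw => by simpa using hw k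
  have hupd : ∀ (w : Fin n → ℂ) (x : ℂ),
      ∏ k, torusFactor (ρ k) (ζ k) (Function.update w j x k) =
        ((1 - conj (ζ j) * x)⁻¹ - 1) *
          ∏ k ∈ Finset.univ.erase j, torusFactor (ρ k) (ζ k) (w k) := by
    intro w x
    rw [← Finset.mul_prod_erase _ _ (Finset.mem_univ j)]
    congr 1
    · rw [hj', Function.update_self, torusFactor, map_sub, conj_cauchyKernel, map_one]
    · refine Finset.prod_congr rfl fun k hk => ?_
      rw [Function.update_of_ne (Finset.ne_of_mem_erase hk)]
  have hd : DiffContOnCl ℂ (fun x => (1 - conj (ζ j) * x)⁻¹ - 1) (ball 0 1) := by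
    refine DifferentiableOn.diffContOnCl fun x hx => ?_
    rw [closure_ball (0 : ℂ) one_ne_zero] at hx
    have := one_sub_conj_mul_ne_zero (hζ j) (by simpa using hx : ‖x‖ ≤ 1)
    refine DifferentiableAt.differentiableWithinAt ?_
    fun_prop (disch := exact this)
  rw [integral_torus_eq_update_zero j hcont (fun w hw => by
    simp only [hupd]
    exact (diffContOnCl_update hF j hw).smul (hd.smul (diffContOnCl_const (c :=
      ∏ k ∈ Finset.univ.erase j, torusFactor (ρ k) (ζ k) (w k)))))]
  simp only [hupd]
  simp

/-- The mean of `F · conj (∏ cauchyKernel)` over the torus is `F 0`. -/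
lemma integral_mul_conj_prod_cauchyKernel {F : (Fin n → ℂ) → ℂ}
    (hF : ∀ w ∈ closedPolydisc n, DifferentiableAt ℂ F w) {ζ : Fin n → ℂ} (hζ : ∀ j, ‖ζ j‖ < 1) :
    ∫ τ, F (torusCoe τ) * conj (∏ k, cauchyKernel (ζ k) (torusCoe τ k)) ∂torusMeasure n = F 0 := by
  have h := cauchy_torus (F := fun w => F w * ∏ k, (1 - conj (ζ k) * w k)⁻¹) (fun w hw => by
    refine (hF w hw).mul ?_
    refine (HasFDerivAt.finsetProd fun k _ => DifferentiableAt.hasFDerivAt ?_).differentiableAt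
    have := one_sub_conj_mul_ne_zero (hζ k) (hw k)
    fun_prop (disch := exact this)) (ζ := 0) (by simp)
  simpa [map_prod, conj_cauchyKernel] using h

/-- The measure `Re F dm` on the torus. -/
def reMeasure (F : (Fin n → ℂ) → ℂ) : Measure (Fin n → UnitCircle) :=
  (torusMeasure n).withDensity fun τ => ENNReal.ofReal (F (torusCoe τ)).re

lemma continuous_comp_torusCoe {F : (Fin n → ℂ) → ℂ}
    (hF : ∀ w ∈ closedPolydisc n, DifferentiableAt ℂ F w) :
    Continuous fun τ : Fin n → UnitCircle => F (torusCoe τ) := by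
  have hFc : ContinuousOn F (closedPolydisc n) := fun w hw =>
    (hF w hw).continuousAt.continuousWithinAt
  exact hFc.comp_continuous continuous_torusCoe torusCoe_mem

lemma isFiniteMeasure_reMeasure {F : (Fin n → ℂ) → ℂ}
    (hF : ∀ w ∈ closedPolydisc n, DifferentiableAt ℂ F w) :
    IsFiniteMeasure (reMeasure F) :=
  isFiniteMeasure_withDensity_ofReal (integrable_of_continuous_torus
    (Complex.continuous_re.comp (continuous_comp_torusCoe hF))).2

lemma integral_reMeasure {F : (Fin n → ℂ) → ℂ}
    (hF : ∀ w ∈ closedPolydisc n, DifferentiableAt ℂ F w)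
    (hre : ∀ w ∈ closedPolydisc n, 0 ≤ (F w).re)
    {g : (Fin n → UnitCircle) → ℂ} (hg : Continuous g) :
    ∫ τ, g τ ∂reMeasure F =
      2⁻¹ * (∫ τ, F (torusCoe τ) * g τ ∂torusMeasure n +
        conj (∫ τ, F (torusCoe τ) * conj (g τ) ∂torusMeasure n)) := by
  have hc := continuous_comp_torusCoe hF
  have hm : Measurable fun τ : Fin n → UnitCircle => ENNReal.ofReal (F (torusCoe τ)).re :=
    (Complex.continuous_re.comp hc).measurable.ennreal_ofReal
  rw [reMeasure, integral_withDensity_eq_integral_toReal_smul hm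
    (.of_forall fun _ => ENNReal.ofReal_lt_top), ← integral_conj, ← integral_add,
    ← integral_const_mul]
  · refine integral_congr_ae (.of_forall fun τ => ?_)
    simp only
    rw [ENNReal.toReal_ofReal (hre _ (torusCoe_mem τ)), Complex.real_smul, Complex.re_eq_add_conj]
    simp only [map_mul, Complex.conj_conj]
    ring
  · exact integrable_of_continuous_torus (hc.mul hg)
  · refine integrable_of_continuous_torus ?_
    exact Complex.continuous_conj.comp (hc.mul (Complex.continuous_conj.comp hg))

lemma integral_one_reMeasure {F : (Fin n → ℂ) → ℂ}
    (hF : ∀ w ∈ closedPolydisc n, DifferentiableAt ℂ F w)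
    (hre : ∀ w ∈ closedPolydisc n, 0 ≤ (F w).re) :
    ∫ _, (1 : ℂ) ∂reMeasure F = (F 0).re := by
  have h := cauchy_torus hF (ζ := 0) (by simp)
  simp only [Pi.zero_apply, cauchyKernel_zero, Finset.prod_const_one] at h
  rw [integral_reMeasure hF hre continuous_const]
  simp only [map_one, h]
  rw [Complex.re_eq_add_conj]
  ring

lemma eq_integral_reMeasure {F : (Fin n → ℂ) → ℂ}
    (hF : ∀ w ∈ closedPolydisc n, DifferentiableAt ℂ F w)
    (hre : ∀ w ∈ closedPolydisc n, 0 ≤ (F w).re)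
    {ζ : Fin n → ℂ} (hζ : ∀ j, ‖ζ j‖ < 1) :
    F ζ = Complex.I * (F 0).im +
      ∫ τ, (2 * ∏ j, cauchyKernel (ζ j) (torusCoe τ j) - 1) ∂reMeasure F := by
  have := isFiniteMeasure_reMeasure hF
  have hc : Continuous fun τ : Fin n → UnitCircle => ∏ j, cauchyKernel (ζ j) (torusCoe τ j) :=
    continuous_finsetProd _ fun j _ => continuous_torus_cauchyKernel (hζ j) j
  rw [integral_sub ((integrable_of_continuous_torus hc).const_mul 2) (integrable_const _),
    integral_const_mul, integral_reMeasure hF hre hc,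
    integral_one_reMeasure hF hre, cauchy_torus hF hζ, integral_mul_conj_prod_cauchyKernel hF hζ]
  apply Complex.ext <;> simp

lemma integral_prod_torusFactor_reMeasure {F : (Fin n → ℂ) → ℂ}
    (hF : ∀ w ∈ closedPolydisc n, DifferentiableAt ℂ F w)
    (hre : ∀ w ∈ closedPolydisc n, 0 ≤ (F w).re)
    {ζ : Fin n → ℂ} (hζ : ∀ j, ‖ζ j‖ < 1)
    {ρ : Fin n → SignType} (h1 : ∃ j, ρ j = -1) (h2 : ∃ j, ρ j = 1) :
    ∫ τ, ∏ j, torusFactor (ρ j) (ζ j) (torusCoe τ j) ∂reMeasure F = 0 := by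
  obtain ⟨j, hj⟩ := h1
  obtain ⟨k, hk⟩ := h2
  rw [integral_reMeasure hF hre (continuous_finsetProd _ fun j _ =>
    continuous_torus_torusFactor (ρ j) (hζ j) j), integral_mul_prod_torusFactor hF hζ hk]
  simp only [map_prod, conj_torusFactor]
  rw [integral_mul_prod_torusFactor (ρ := fun k => - ρ k) hF hζ (j := j) (by simp [hj])]
  simp

/-- The Herglotz representation on the polydisc: a holomorphic function with non-negative real part
is, up to an imaginary constant, an integral of `2 ∏ (1 - ζⱼ conj τⱼ)⁻¹ - 1` with respect to
a positive measure on the torus whose moments of mixed sign vanish. The measure is a weak limit of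
the measures `Re F(rτ) dm(τ)` as `r → 1`. -/
theorem exists_torus_measure {F : (Fin n → ℂ) → ℂ}
    (hF : DifferentiableOn ℂ F {w | ∀ j, ‖w j‖ < 1}) (hre : ∀ w, (∀ j, ‖w j‖ < 1) → 0 ≤ (F w).re) :
    ∃ ν : Measure (Fin n → UnitCircle), IsFiniteMeasure ν ∧
      (∀ ζ : Fin n → ℂ, (∀ j, ‖ζ j‖ < 1) → F ζ = Complex.I * (F 0).im +
        ∫ τ, (2 * ∏ j, cauchyKernel (ζ j) (torusCoe τ j) - 1) ∂ν) ∧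
      ∀ ζ : Fin n → ℂ, (∀ j, ‖ζ j‖ < 1) → ∀ ρ : Fin n → SignType,
        (∃ j, ρ j = -1) → (∃ j, ρ j = 1) →
        ∫ τ, ∏ j, torusFactor (ρ j) (ζ j) (torusCoe τ j) ∂ν = 0 := by
  set r : ℕ → ℝ := fun k => 1 - 1 / ((k : ℝ) + 1) with hr
  have hr0 : ∀ k, 0 ≤ r k := fun k => by
    have : 1 / ((k : ℝ) + 1) ≤ 1 := by rw [div_le_one (by positivity)]; simp
    simp only [hr]; linarith
  have hr1 : ∀ k, r k < 1 := fun k => by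
    have : 0 < 1 / ((k : ℝ) + 1) := by positivity
    simp only [hr]; linarith
  have hrlim : Tendsto r atTop (𝓝 1) := by
    simpa [hr] using (tendsto_const_nhds (x := (1 : ℝ))).sub tendsto_one_div_add_atTop_nhds_zero_nat
  have hopen : IsOpen {w : Fin n → ℂ | ∀ j, ‖w j‖ < 1} := by
    simp only [Set.ofPred_forall]
    exact isOpen_iInter_of_finite fun j => isOpen_lt (by fun_prop) continuous_const
  set Fr : ℕ → (Fin n → ℂ) → ℂ := fun k w => F ((r k : ℂ) • w)
  have hmem : ∀ k, ∀ w ∈ closedPolydisc n, ∀ j, ‖((r k : ℂ) • w) j‖ < 1 := by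
    intro k w hw j
    rw [Pi.smul_apply, smul_eq_mul, norm_mul, Complex.norm_real, Real.norm_of_nonneg (hr0 k)]
    nlinarith [hr0 k, hr1 k, hw j, norm_nonneg (w j)]
  have hFd : ∀ k, ∀ w ∈ closedPolydisc n, DifferentiableAt ℂ (Fr k) w := fun k w hw =>
    (((hF _ (hmem k w hw)).differentiableAt (hopen.mem_nhds (hmem k w hw))).comp w
      (by fun_prop : DifferentiableAt ℂ (fun w : Fin n → ℂ => (r k : ℂ) • w) w))
  have hFre : ∀ k, ∀ w ∈ closedPolydisc n, 0 ≤ (Fr k w).re := fun k w hw => hre _ (hmem k w hw)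
  have hFr0 : ∀ k, Fr k 0 = F 0 := fun k => by simp [Fr]
  let ν : ℕ → FiniteMeasure (Fin n → UnitCircle) := fun k =>
    ⟨reMeasure (Fr k), isFiniteMeasure_reMeasure (hFd k)⟩
  have hmass : ∀ k, (ν k).mass ≤ Real.toNNReal (F 0).re := by
    intro k
    have := isFiniteMeasure_reMeasure (hFd k)
    have h := integral_one_reMeasure (hFd k) (hFre k)
    rw [hFr0, integral_const, Complex.real_smul, mul_one, Complex.ofReal_inj] at h
    rw [← NNReal.coe_le_coe, Real.coe_toNNReal _ (hre 0 (by simp)), ← h]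
    rfl
  -- weak limit along an ultrafilter
  obtain ⟨ν₀, -, hν₀⟩ := isCompact_iff_ultrafilter_le_nhds.1
    (isCompact_setOfPred_finiteMeasure_le_of_compactSpace (Fin n → UnitCircle)
      (Real.toNNReal (F 0).re)) ((hyperfilter ℕ).map ν) (by
        rw [le_principal_iff]
        exact Filter.mem_map.2 (Filter.univ_mem' hmass))
  have hlim : ∀ g : (Fin n → UnitCircle) → ℂ, Continuous g →
      Tendsto (fun k => ∫ τ, g τ ∂reMeasure (Fr k)) (hyperfilter ℕ) (𝓝 (∫ τ, g τ ∂ν₀)) :=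
    fun g hg => (FiniteMeasure.tendsto_iff_forall_integral_rclike_tendsto ℂ).1 hν₀
      (BoundedContinuousFunction.mkOfCompact ⟨g, hg⟩)
  refine ⟨ν₀, inferInstance, fun ζ hζ => ?_, fun ζ hζ ρ h1 h2 => ?_⟩
  · have hcv := (hlim (fun τ => 2 * ∏ j, cauchyKernel (ζ j) (torusCoe τ j) - 1)
      ((continuous_const.mul (continuous_finsetProd _ fun j _ =>
        continuous_torus_cauchyKernel (hζ j) j)).sub continuous_const)).const_add
        (Complex.I * (F 0).im)
    have hcv2 : Tendsto (fun k => Fr k ζ) (hyperfilter ℕ) (𝓝 (F ζ)) := by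
      refine Tendsto.mono_left ?_ Nat.hyperfilter_le_atTop
      have hc : ContinuousAt F ζ := ((hF ζ hζ).differentiableAt (hopen.mem_nhds hζ)).continuousAt
      refine hc.tendsto.comp ?_
      have : Tendsto (fun k => (r k : ℂ) • ζ) atTop (𝓝 ((1 : ℝ) • ζ)) :=
        hrlim.smul_const ζ
      simpa using this
    refine tendsto_nhds_unique hcv2 (hcv.congr fun k => ?_)
    rw [eq_integral_reMeasure (hFd k) (hFre k) hζ, hFr0]
  · refine tendsto_nhds_unique (hlim (fun τ => ∏ j, torusFactor (ρ j) (ζ j) (torusCoe τ j))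
      (continuous_finsetProd _ fun j _ => continuous_torus_torusFactor (ρ j) (hζ j) j)) ?_
    refine tendsto_const_nhds.congr fun k => ?_
    rw [integral_prod_torusFactor_reMeasure (hFd k) (hFre k) hζ h1 h2]

/-! ### The factors of the kernel -/

/-- The factors of the first product in the kernel: for `z` in the upper half-plane, the Cauchy
kernel of the half-plane with the normalization `halfPlaneFactor I t = 1 / (1 + t²)`. -/
def halfPlaneFactor (z : ℂ) (t : ℝ) : ℂ :=
  1 / (2 * Complex.I) * (1 / (t - z) - 1 / (t + Complex.I))

/-- The density `1 / (1 + t²)`. -/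
def cauchyWeight (t : ℝ) : ℝ := 1 / (1 + t ^ 2)

lemma cauchyWeight_pos (t : ℝ) : 0 < cauchyWeight t := by unfold cauchyWeight; positivity

lemma continuous_cauchyWeight : Continuous cauchyWeight := by
  unfold cauchyWeight
  exact continuous_const.div (by fun_prop) fun t => by positivity

lemma ofReal_sub_ne_zero {z : ℂ} (hz : z.im ≠ 0) (t : ℝ) : (t : ℂ) - z ≠ 0 := by
  intro h
  have := congrArg Complex.im h
  simp at this
  exact hz this

lemma ofReal_add_I_ne_zero (t : ℝ) : (t : ℂ) + Complex.I ≠ 0 := by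
  simpa using ofReal_sub_ne_zero (z := -Complex.I) (by simp) t

lemma ofReal_sub_I_ne_zero (t : ℝ) : (t : ℂ) - Complex.I ≠ 0 :=
  ofReal_sub_ne_zero (by simp) t

lemma ofReal_cauchyWeight (t : ℝ) :
    (cauchyWeight t : ℂ) = 1 / ((t + Complex.I) * (t - Complex.I)) := by
  have h : ((t : ℂ) + Complex.I) * (t - Complex.I) = 1 + t ^ 2 := by
    linear_combination -Complex.I_sq
  rw [h]; simp [cauchyWeight]

/-- The quotient of `halfPlaneFactor` and `cauchyWeight`, written so that it is visibly bounded
in `t` and holomorphic in `z`. -/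
def factorRatio (z : ℂ) (t : ℝ) : ℂ :=
  (z + Complex.I) / (2 * Complex.I) * (1 + (z - Complex.I) / (t - z))

lemma halfPlaneFactor_eq {z : ℂ} (hz : z.im ≠ 0) (t : ℝ) :
    halfPlaneFactor z t = cauchyWeight t * factorRatio z t := by
  have h1 := ofReal_sub_ne_zero hz t
  have h2 := ofReal_add_I_ne_zero t
  have h3 := ofReal_sub_I_ne_zero t
  have h4 := Complex.I_ne_zero
  rw [ofReal_cauchyWeight, halfPlaneFactor, factorRatio]
  field_simp
  ring

lemma continuous_factorRatio {z : ℂ} (hz : z.im ≠ 0) : Continuous (factorRatio z) := by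
  unfold factorRatio
  exact continuous_const.mul (continuous_const.add
    (continuous_const.div (by fun_prop) fun t => ofReal_sub_ne_zero hz t))

lemma abs_im_le_norm_ofReal_sub (z : ℂ) (t : ℝ) : |z.im| ≤ ‖(t : ℂ) - z‖ := by
  simpa using Complex.abs_im_le_norm ((t : ℂ) - z)

lemma norm_factorRatio_le {z : ℂ} (hz : z.im ≠ 0) (t : ℝ) :
    ‖factorRatio z t‖ ≤ ‖z + Complex.I‖ / 2 * (1 + ‖z - Complex.I‖ / |z.im|) := by
  rw [factorRatio, norm_mul, norm_div]
  have : ‖(2 * Complex.I : ℂ)‖ = 2 := by simp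
  rw [this]
  gcongr
  refine (norm_add_le _ _).trans ?_
  rw [norm_one, norm_div]
  have := abs_pos.2 hz
  gcongr
  exact abs_im_le_norm_ofReal_sub z t

lemma factorRatio_I (t : ℝ) : factorRatio Complex.I t = 1 := by
  have := Complex.I_ne_zero
  simp only [factorRatio, sub_self, zero_div, add_zero, mul_one]
  field_simp
  norm_num

lemma halfPlaneFactor_I (t : ℝ) : halfPlaneFactor Complex.I t = cauchyWeight t := by
  rw [halfPlaneFactor_eq (by simp), factorRatio_I, mul_one]

lemma continuous_halfPlaneFactor {z : ℂ} (hz : z.im ≠ 0) : Continuous (halfPlaneFactor z) := by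
  rw [funext (halfPlaneFactor_eq hz)]
  exact (Complex.continuous_ofReal.comp continuous_cauchyWeight).mul (continuous_factorRatio hz)

/-- The behaviour of the factors under reflection in the real line, on which the symmetry formula
rests. -/
lemma conj_halfPlaneFactor_conj (z : ℂ) (t : ℝ) :
    conj (halfPlaneFactor (conj z) t) = cauchyWeight t - halfPlaneFactor z t := by
  rw [← halfPlaneFactor_I]
  simp only [halfPlaneFactor, map_mul, map_div₀, map_sub, map_add, map_one, Complex.conj_I,
    Complex.conj_ofReal, Complex.conj_conj, map_ofNat]
  have := Complex.I_ne_zero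
  field_simp
  ring

lemma nFactor_neg (z : ℂ) (t : ℝ) :
    nFactor SignType.neg z t = halfPlaneFactor z t - cauchyWeight t := by
  rw [← halfPlaneFactor_I, nFactor, halfPlaneFactor, halfPlaneFactor]; ring

lemma nFactor_zero (z : ℂ) (t : ℝ) : nFactor SignType.zero z t = cauchyWeight t := by
  rw [← halfPlaneFactor_I, nFactor, halfPlaneFactor]

lemma nFactor_pos (z : ℂ) (t : ℝ) : nFactor SignType.pos z t = - halfPlaneFactor (conj z) t := by
  rw [nFactor, halfPlaneFactor]; ring

lemma nFactor_pos_eq_conj (z : ℂ) (t : ℝ) :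
    nFactor SignType.pos z t = conj (nFactor SignType.neg z t) := by
  have h := congrArg conj (conj_halfPlaneFactor_conj z t)
  rw [Complex.conj_conj] at h
  rw [nFactor_pos, h, nFactor_neg, ← map_neg, neg_sub]

lemma kernel_eq (z : Fin n → ℂ) (t : Fin n → ℝ) :
    kernel z t = Complex.I * (2 * ∏ l, halfPlaneFactor (z l) (t l) -
      ((∏ l, cauchyWeight (t l) : ℝ) : ℂ)) := by
  have h : ((∏ l, cauchyWeight (t l) : ℝ) : ℂ) = ∏ l, halfPlaneFactor Complex.I (t l) := by
    simp [halfPlaneFactor_I]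
  simp only [kernel, h, halfPlaneFactor, Finset.prod_mul_distrib, Finset.prod_const,
    Finset.card_univ, Fintype.card_fin]
  rw [one_div_pow]
  ring

lemma continuous_kernel {z : Fin n → ℂ} (hz : z ∈ polyCut n) : Continuous (kernel z) := by
  rw [funext (kernel_eq z)]
  refine continuous_const.mul ((continuous_const.mul (continuous_finsetProd _ fun l _ =>
    (continuous_halfPlaneFactor (hz l)).comp (continuous_apply l))).sub ?_)
  exact Complex.continuous_ofReal.comp (continuous_finsetProd _ fun l _ =>
    continuous_cauchyWeight.comp (continuous_apply l))

/-! ### The Cayley transform -/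

/-- The Cayley transform, mapping the upper half-plane onto the unit disc. -/
def cayley (z : ℂ) : ℂ := (z - Complex.I) / (z + Complex.I)

/-- The inverse of the Cayley transform. -/
def invCayley (ζ : ℂ) : ℂ := Complex.I * (1 + ζ) / (1 - ζ)

lemma add_I_ne_zero {z : ℂ} (hz : 0 < z.im) : z + Complex.I ≠ 0 := by
  intro h
  have := congrArg Complex.im h
  simp at this
  linarith

lemma norm_cayley_lt_one {z : ℂ} (hz : 0 < z.im) : ‖cayley z‖ < 1 := by
  rw [cayley, norm_div, div_lt_one (norm_pos_iff.2 (add_I_ne_zero hz))]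
  rw [← sq_lt_sq₀ (norm_nonneg _) (norm_nonneg _), ← Complex.normSq_eq_norm_sq,
    ← Complex.normSq_eq_norm_sq, Complex.normSq_apply, Complex.normSq_apply]
  simp
  nlinarith

lemma invCayley_cayley {z : ℂ} (hz : z + Complex.I ≠ 0) : invCayley (cayley z) = z := by
  have h4 := Complex.I_ne_zero
  have h : (1 - (z - Complex.I) / (z + Complex.I)) = 2 * Complex.I / (z + Complex.I) := by
    field_simp; ring
  rw [invCayley, cayley, h]
  field_simp
  ring

lemma cayley_invCayley {ζ : ℂ} (hζ : ζ ≠ 1) : cayley (invCayley ζ) = ζ := by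
  have h1 : 1 - ζ ≠ 0 := sub_ne_zero.2 hζ.symm
  have h4 := Complex.I_ne_zero
  have h : Complex.I * (1 + ζ) / (1 - ζ) + Complex.I = 2 * Complex.I / (1 - ζ) := by
    field_simp; ring
  rw [cayley, invCayley, h]
  field_simp
  ring

lemma invCayley_im (ζ : ℂ) :
    (invCayley ζ).im = (1 - Complex.normSq ζ) / Complex.normSq (1 - ζ) := by
  rw [invCayley, Complex.div_im]
  simp [Complex.normSq_apply]
  ring

lemma invCayley_im_pos {ζ : ℂ} (hζ : ‖ζ‖ < 1) : 0 < (invCayley ζ).im := by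
  rw [invCayley_im]
  have h1 : 1 - ζ ≠ 0 := by
    intro h
    rw [← sub_eq_zero.1 h] at hζ
    simp at hζ
  have h2 : 0 < Complex.normSq (1 - ζ) := Complex.normSq_pos.2 h1
  have h3 : Complex.normSq ζ < 1 := by
    rw [Complex.normSq_eq_norm_sq]; nlinarith [norm_nonneg ζ]
  exact div_pos (by linarith) h2

lemma invCayley_zero : invCayley 0 = Complex.I := by simp [invCayley]

/-- The inverse Cayley transform of a point of the circle, as a real number; at the point `1`,
which corresponds to infinity, the value is `0`. -/
def circleToReal (s : UnitCircle) : ℝ := (invCayley s).re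

lemma measurable_circleToReal : Measurable circleToReal := by
  unfold circleToReal invCayley
  fun_prop

lemma cayley_circleToReal {s : UnitCircle} (hs : (s : ℂ) ≠ 1) : cayley (circleToReal s) = s := by
  have h : ((circleToReal s : ℝ) : ℂ) = invCayley s := by
    refine Complex.ext rfl ?_
    have hn : ‖(s : ℂ)‖ = 1 := mem_sphere_zero_iff_norm.1 s.2
    rw [invCayley_im, Complex.normSq_eq_norm_sq (s : ℂ), hn]
    simp
  rw [h, cayley_invCayley hs]

lemma factorRatio_eq_cauchyKernel {z : ℂ} (hz : 0 < z.im) (t : ℝ) :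
    factorRatio z t = cauchyKernel (cayley z) (cayley t) := by
  have h1 := ofReal_sub_ne_zero hz.ne' t
  have h2 := ofReal_add_I_ne_zero t
  have h3 := ofReal_sub_I_ne_zero t
  have h4 := Complex.I_ne_zero
  have h5 := add_I_ne_zero hz
  have h6 : 1 - (z - Complex.I) / (z + Complex.I) * ((t + Complex.I) / (t - Complex.I)) =
      2 * Complex.I * (t - z) / ((z + Complex.I) * (t - Complex.I)) := by
    field_simp
    ring
  have h7 : conj (cayley t) = (t + Complex.I) / (t - Complex.I) := by
    simp [cayley, sub_eq_add_neg]
  rw [cauchyKernel, h7, cayley, h6, factorRatio]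
  field_simp
  ring

lemma nFactor_eq {z : ℂ} (hz : 0 < z.im) (σ : SignType) (t : ℝ) :
    nFactor σ z t = cauchyWeight t * torusFactor σ (cayley z) (cayley t) := by
  have h : nFactor SignType.neg z t =
      cauchyWeight t * torusFactor SignType.neg (cayley z) (cayley t) := by
    rw [nFactor_neg, halfPlaneFactor_eq hz.ne', factorRatio_eq_cauchyKernel hz, torusFactor]
    ring
  cases σ
  · exact (nFactor_zero z t).trans (mul_one _).symm
  · exact h
  · rw [nFactor_pos_eq_conj, h, map_mul, Complex.conj_ofReal]
    rfl

lemma continuous_nFactor {z : ℂ} (hz : 0 < z.im) (σ : SignType) : Continuous (nFactor σ z) := by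
  have h0 := Complex.continuous_ofReal.comp continuous_cauchyWeight
  have h : Continuous (nFactor SignType.neg z) := by
    rw [funext (nFactor_neg z)]
    exact (continuous_halfPlaneFactor hz.ne').sub h0
  cases σ
  · exact (funext (nFactor_zero z)) ▸ h0
  · exact h
  · rw [show nFactor SignType.pos z = fun t => conj (nFactor SignType.neg z t) from
      funext (nFactor_pos_eq_conj z)]
    exact Complex.continuous_conj.comp h

/-! ### From the torus to the real space -/

/-- The measure on `ℝⁿ` corresponding to a measure on the torus under the Cayley transform,
multiplied by the density `πⁿ ∏ (1 + tⱼ²)`. -/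
def lineMeasure (ν : Measure (Fin n → UnitCircle)) : Measure (Fin n → ℝ) :=
  (ν.map fun τ j => circleToReal (τ j)).withDensity
    fun t => ENNReal.ofReal (Real.pi ^ n * (∏ j, cauchyWeight (t j))⁻¹)

lemma measurable_lineMap :
    Measurable fun (τ : Fin n → UnitCircle) (j : Fin n) => circleToReal (τ j) :=
  measurable_pi_lambda _ fun j => measurable_circleToReal.comp (measurable_pi_apply j)

lemma continuous_prod_cauchyWeight :
    Continuous fun t : Fin n → ℝ => ∏ j, cauchyWeight (t j) :=
  continuous_finsetProd _ fun j _ => continuous_cauchyWeight.comp (continuous_apply j)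

lemma prod_cauchyWeight_pos (t : Fin n → ℝ) : 0 < ∏ j, cauchyWeight (t j) :=
  Finset.prod_pos fun j _ => cauchyWeight_pos (t j)

lemma measurable_lineDensity : Measurable fun t : Fin n → ℝ =>
    ENNReal.ofReal (Real.pi ^ n * (∏ j, cauchyWeight (t j))⁻¹) :=
  (continuous_prod_cauchyWeight.measurable.inv.const_mul _).ennreal_ofReal

lemma growthCondition_lineMeasure (ν : Measure (Fin n → UnitCircle)) [IsFiniteMeasure ν] :
    GrowthCondition (lineMeasure ν) := by
  have hm : Measurable fun t : Fin n → ℝ => ENNReal.ofReal (∏ l, 1 / (1 + t l ^ 2)) :=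
    continuous_prod_cauchyWeight.measurable.ennreal_ofReal
  rw [GrowthCondition, lineMeasure,
    lintegral_withDensity_eq_lintegral_mul _ measurable_lineDensity hm]
  have h : ∀ t : Fin n → ℝ, ((fun t : Fin n → ℝ =>
      ENNReal.ofReal (Real.pi ^ n * (∏ j, cauchyWeight (t j))⁻¹)) *
      fun t : Fin n → ℝ => ENNReal.ofReal (∏ l, 1 / (1 + t l ^ 2))) t =
      ENNReal.ofReal (Real.pi ^ n) := by
    intro t
    have hp := prod_cauchyWeight_pos t
    rw [Pi.mul_apply, ← ENNReal.ofReal_mul (by positivity)]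
    change ENNReal.ofReal (Real.pi ^ n * (∏ j, cauchyWeight (t j))⁻¹ * ∏ j, cauchyWeight (t j)) = _
    rw [mul_assoc, inv_mul_cancel₀ hp.ne', mul_one]
  rw [lintegral_congr h, lintegral_const, Measure.map_apply measurable_lineMap MeasurableSet.univ]
  exact ENNReal.mul_lt_top ENNReal.ofReal_lt_top (measure_lt_top _ _)

/-- Change of variables from `lineMeasure ν` to `ν`, when `ν` has no mass at infinity. -/
lemma integral_lineMeasure {ν : Measure (Fin n → UnitCircle)}
    (hν : ∀ᵐ τ ∂ν, ∀ j, (τ j : ℂ) ≠ 1) {G : (Fin n → ℝ) → ℂ} (hG : Continuous G)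
    {H : (Fin n → ℂ) → ℂ}
    (hGH : ∀ t, G t = ((∏ j, cauchyWeight (t j) : ℝ) : ℂ) * H fun j => cayley (t j)) :
    ∫ t, G t ∂lineMeasure ν = (Real.pi : ℂ) ^ n * ∫ τ, H (torusCoe τ) ∂ν := by
  rw [lineMeasure, integral_withDensity_eq_integral_toReal_smul measurable_lineDensity
    (.of_forall fun _ => ENNReal.ofReal_lt_top), integral_map measurable_lineMap.aemeasurable,
    ← integral_const_mul]
  · refine integral_congr_ae (hν.mono fun τ hτ => ?_)
    have hp := prod_cauchyWeight_pos fun j => circleToReal (τ j)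
    simp only
    rw [ENNReal.toReal_ofReal (by positivity), hGH, Complex.real_smul, ← mul_assoc,
      ← Complex.ofReal_mul, mul_assoc, inv_mul_cancel₀ hp.ne', mul_one, Complex.ofReal_pow]
    congr 2
    funext j
    exact cayley_circleToReal (hτ j)
  · refine AEStronglyMeasurable.smul ?_ hG.aestronglyMeasurable
    exact (Complex.measurable_ofReal.comp
      measurable_lineDensity.ennreal_toReal).aestronglyMeasurable

lemma re_two_mul_cauchyKernel_sub_one {r : ℝ} (hr0 : 0 ≤ r) (hr1 : r < 1) (s : UnitCircle) :
    0 ≤ (2 * cauchyKernel r s - 1).re := by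
  have hs : ‖(s : ℂ)‖ = 1 := mem_sphere_zero_iff_norm.1 s.2
  have hne := one_sub_mul_conj_ne_zero (ζ := (r : ℂ)) (w := s)
    (by rwa [Complex.norm_real, Real.norm_of_nonneg hr0]) hs.le
  have hpos := Complex.normSq_pos.2 hne
  have hs2 : Complex.normSq (s : ℂ) = 1 := by rw [Complex.normSq_eq_norm_sq, hs, one_pow]
  have h : (2 * cauchyKernel r s - 1).re =
      (1 - r ^ 2) / Complex.normSq (1 - r * conj (s : ℂ)) := by
    rw [eq_div_iff hpos.ne']
    have : (2 * cauchyKernel r s - 1).re =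
        2 * (1 - r * conj (s : ℂ)).re / Complex.normSq (1 - r * conj (s : ℂ)) - 1 := by
      simp [cauchyKernel, Complex.inv_re]
      ring
    rw [this, sub_mul, div_mul_cancel₀ _ hpos.ne']
    rw [Complex.normSq_apply] at hs2 ⊢
    simp
    linear_combination r ^ 2 * (-hs2)
  rw [h]
  exact div_nonneg (by nlinarith) hpos.le

/-- The mass of a Herglotz measure at the points with `j`-th coordinate `1` is bounded by the values
of the function along the `j`-th radius. -/
lemma mass_infinity_le {ν : Measure (Fin n → UnitCircle)} [IsFiniteMeasure ν]
    {F : (Fin n → ℂ) → ℂ} (hF : ∀ ζ : Fin n → ℂ, (∀ j, ‖ζ j‖ < 1) → F ζ = Complex.I * (F 0).im +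
        ∫ τ, (2 * ∏ j, cauchyKernel (ζ j) (torusCoe τ j) - 1) ∂ν)
    (j : Fin n) {r : ℝ} (hr0 : 0 ≤ r) (hr1 : r < 1) :
    (1 + r) / (1 - r) * ν.real {τ | (τ j : ℂ) = 1} ≤ (F (Function.update 0 j (r : ℂ))).re := by
  have hr : ‖(r : ℂ)‖ < 1 := by rwa [Complex.norm_real, Real.norm_of_nonneg hr0]
  have hprod : ∀ τ : Fin n → UnitCircle,
      ∏ k, cauchyKernel ((Function.update 0 j (r : ℂ) : Fin n → ℂ) k) (torusCoe τ k) =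
        cauchyKernel r (τ j) := by
    intro τ
    rw [← Finset.mul_prod_erase _ _ (Finset.mem_univ j), Function.update_self,
      Finset.prod_eq_one, mul_one]
    · rfl
    · intro k hk
      simp [Finset.ne_of_mem_erase hk]
  rw [hF _ fun k => by
    by_cases hk : k = j
    · subst hk; simpa using hr
    · simp [hk]]
  simp only [hprod]
  have hc : Continuous fun τ : Fin n → UnitCircle => 2 * cauchyKernel r (τ j) - 1 :=
    (continuous_const.mul ((continuous_cauchyKernel_circle hr).comp (continuous_apply j))).sub
      continuous_const
  have hint : Integrable (fun τ : Fin n → UnitCircle => 2 * cauchyKernel r (τ j) - 1) ν :=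
    integrable_of_continuous_torus hc
  have hms : MeasurableSet {τ : Fin n → UnitCircle | (τ j : ℂ) = 1} :=
    (isClosed_eq (by fun_prop) continuous_const).measurableSet
  have hre : (∫ τ, (2 * cauchyKernel r (τ j) - 1) ∂ν).re =
      ∫ τ, (2 * cauchyKernel r (τ j) - 1).re ∂ν := (integral_re hint).symm
  simp only [Complex.add_re, Complex.mul_re, Complex.I_re, Complex.I_im, Complex.ofReal_re,
    Complex.ofReal_im, zero_mul, mul_zero, sub_zero, zero_add]
  rw [hre, mul_comm, ← smul_eq_mul, ← integral_indicator_const _ hms]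
  refine integral_mono ((integrable_const _).indicator hms) hint.re fun τ => ?_
  by_cases h1 : (τ j : ℂ) = 1
  · rw [indicator_of_mem (by exact h1)]
    have h2 : (2 * cauchyKernel (r : ℂ) (τ j) - 1) = (((1 + r) / (1 - r) : ℝ) : ℂ) := by
      have h3 : (1 : ℂ) - r ≠ 0 := by
        rw [← Complex.ofReal_one, ← Complex.ofReal_sub]
        exact Complex.ofReal_ne_zero.2 (by linarith)
      rw [cauchyKernel, h1]
      push_cast
      simp
      field_simp
      ring
    simp only [h2]
    exact le_of_eq (Complex.ofReal_re _).symm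
  · rw [indicator_of_notMem (by exact h1)]
    exact re_two_mul_cauchyKernel_sub_one hr0 hr1 (τ j)

lemma cayley_mul_I {y : ℝ} (hy : 1 ≤ y) :
    cayley (y * Complex.I) = (((y - 1) / (y + 1) : ℝ) : ℂ) := by
  have h4 := Complex.I_ne_zero
  have : (y : ℂ) + 1 ≠ 0 := by
    rw [← Complex.ofReal_one, ← Complex.ofReal_add]
    exact Complex.ofReal_ne_zero.2 (by linarith)
  have h5 : (y : ℂ) * Complex.I + Complex.I ≠ 0 := by
    have : (y : ℂ) * Complex.I + Complex.I = (y + 1) * Complex.I := by ring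
    rw [this]; positivity
  rw [cayley]
  push_cast
  rw [div_eq_div_iff h5 this]
  ring

/-- The integral representation of a Herglotz–Nevanlinna function without linear term: if the
function grows sublinearly along the imaginary axis in every variable, its Herglotz measure on the
torus has no mass at infinity, and is carried to `ℝⁿ` by the Cayley transform. -/
theorem exists_represents {g : (Fin n → ℂ) → ℂ} (hg : DifferentiableOn ℂ g (polyUpper n))
    (him : ∀ z ∈ polyUpper n, 0 ≤ (g z).im)
    (hlim : ∀ j, Tendsto (fun y : ℝ =>
      (g (Function.update (fun _ => Complex.I) j (y * Complex.I))).im / y) atTop (𝓝 0)) :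
    ∃ (a : ℝ) (μ : Measure (Fin n → ℝ)), GrowthCondition μ ∧ NevanlinnaCondition μ ∧
      ∀ z ∈ polyUpper n, g z = integralFormula a 0 μ z := by
  set F : (Fin n → ℂ) → ℂ := fun ζ => -Complex.I * g fun j => invCayley (ζ j)
  have hmem : ∀ ζ : Fin n → ℂ, (∀ j, ‖ζ j‖ < 1) → (fun j => invCayley (ζ j)) ∈ polyUpper n :=
    fun ζ hζ j => invCayley_im_pos (hζ j)
  have hFre : ∀ ζ, (F ζ).re = (g fun j => invCayley (ζ j)).im := fun ζ => by simp [F]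
  have hFd : DifferentiableOn ℂ F {w | ∀ j, ‖w j‖ < 1} := by
    refine DifferentiableOn.const_mul (hg.comp ?_ hmem) _
    refine differentiableOn_pi.2 fun j ζ hζ => DifferentiableAt.differentiableWithinAt ?_
    have : 1 - ζ j ≠ 0 := by simpa using one_sub_mul_conj_ne_zero (w := 1) (hζ j) (by simp)
    unfold invCayley
    fun_prop (disch := exact this)
  obtain ⟨ν, hνf, hν, hνmix⟩ := exists_torus_measure hFd
    fun ζ hζ => (hFre ζ).symm ▸ him _ (hmem ζ hζ)
  have hFcay : ∀ z ∈ polyUpper n, F (fun j => cayley (z j)) = -Complex.I * g z := by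
    intro z hz
    simp only [F, invCayley_cayley (add_I_ne_zero (hz _))]
  -- the measure has no mass at infinity
  have hinf : ∀ j, ν.real {τ | (τ j : ℂ) = 1} = 0 := by
    intro j
    refine le_antisymm (ge_of_tendsto (hlim j) ?_) measureReal_nonneg
    filter_upwards [eventually_ge_atTop 1] with y hy
    have hy0 : 0 < y := by linarith
    rw [le_div_iff₀ hy0, mul_comm]
    have h := mass_infinity_le hν j (r := (y - 1) / (y + 1))
      (div_nonneg (by linarith) (by linarith)) ((div_lt_one (by linarith)).2 (by linarith))
    have h1 : (1 + (y - 1) / (y + 1)) / (1 - (y - 1) / (y + 1)) = y := by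
      have : y + 1 ≠ 0 := by positivity
      have h2 : 1 - (y - 1) / (y + 1) = 2 / (y + 1) := by field_simp; ring
      rw [h2]; field_simp; ring
    rw [h1] at h
    refine h.trans_eq ?_
    rw [hFre]
    congr 2
    funext k
    by_cases hk : k = j
    · subst hk
      rw [Function.update_self, Function.update_self, ← cayley_mul_I hy]
      refine invCayley_cayley (add_I_ne_zero ?_)
      simpa using hy0
    · rw [Function.update_of_ne hk, Function.update_of_ne hk, Pi.zero_apply, invCayley_zero]
  have hae : ∀ᵐ τ ∂ν, ∀ j, (τ j : ℂ) ≠ 1 := by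
    rw [ae_all_iff]
    intro j
    rw [ae_iff]
    simpa [measureReal_eq_zero_iff] using hinf j
  refine ⟨(g fun _ => Complex.I).re, lineMeasure ν, growthCondition_lineMeasure ν, ?_, ?_⟩
  · intro z hz
    refine Finset.sum_eq_zero fun ρ hρ => ?_
    obtain ⟨h1, h2⟩ := (Finset.mem_filter.1 hρ).2
    have hc : Continuous fun t : Fin n → ℝ => ∏ j, nFactor (ρ j) (z j) (t j) :=
      continuous_finsetProd _ fun j _ => (continuous_nFactor (hz j) (ρ j)).comp (continuous_apply j)
    rw [integral_lineMeasure hae (H := fun w => ∏ j, torusFactor (ρ j) (cayley (z j)) (w j)) hc,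
      hνmix _ (fun j => norm_cayley_lt_one (hz j)) ρ h1 h2, mul_zero]
    intro t
    rw [Finset.prod_congr rfl fun j _ => nFactor_eq (hz j) (ρ j) (t j), Finset.prod_mul_distrib]
    push_cast
    rfl
  · intro z hz
    have hzc : z ∈ polyCut n := fun j => (hz j).ne'
    have hpi : (Real.pi : ℂ) ^ n ≠ 0 := pow_ne_zero _ (Complex.ofReal_ne_zero.2 Real.pi_ne_zero)
    rw [integralFormula, integral_lineMeasure hae (H := fun w =>
      Complex.I * (2 * ∏ j, cauchyKernel (cayley (z j)) (w j) - 1)) (continuous_kernel hzc),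
      integral_const_mul]
    · have h := hν _ fun j => norm_cayley_lt_one (hz j)
      rw [hFcay z hz] at h
      have h0 : (F 0).im = -(g fun _ => Complex.I).re := by
        simp [F, invCayley_zero]
      rw [h0] at h
      simp only [Pi.zero_apply, Complex.ofReal_zero, zero_mul, Finset.sum_const_zero, add_zero]
      rw [← mul_assoc, one_div_mul_cancel hpi, one_mul]
      push_cast at h
      linear_combination Complex.I * h + (g z - (g fun _ => Complex.I).re) * Complex.I_sq
    · intro t
      rw [kernel_eq, Finset.prod_congr rfl fun j _ => (halfPlaneFactor_eq (hzc j) (t j)).trans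
        (congrArg _ (factorRatio_eq_cauchyKernel (hz j) (t j))), Finset.prod_mul_distrib]
      push_cast
      ring

/-! ### Subtracting the linear part -/

lemma normSq_sub_conj (a b : ℂ) :
    Complex.normSq (a - conj b) = Complex.normSq (a - b) + 4 * a.im * b.im := by
  simp only [Complex.normSq_apply, Complex.sub_re, Complex.sub_im, Complex.conj_re,
    Complex.conj_im]
  ring

lemma sub_conj_ne_zero {a b : ℂ} (ha : 0 < a.im) (hb : 0 < b.im) : a - conj b ≠ 0 := by
  intro h
  have := congrArg Complex.im h
  simp at this
  linarith

/-- The Schwarz–Pick inequality on the upper half-plane, between a point and a point of the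
imaginary axis. -/
lemma schwarz_pick {φ : ℂ → ℂ} (hφ : DifferentiableOn ℂ φ {z | 0 < z.im})
    (hpos : ∀ z : ℂ, 0 < z.im → 0 < (φ z).im) {w : ℂ} (hw : 0 < w.im) {y : ℝ} (hy : 0 < y) :
    Complex.normSq (φ w - φ (y * Complex.I)) * (w.im * y) ≤
      (φ w).im * (φ (y * Complex.I)).im * Complex.normSq (w - y * Complex.I) := by
  set p : ℂ := y * Complex.I with hp
  have hpim : p.im = y := by simp [hp]
  have hyc : (y : ℂ) ≠ 0 := Complex.ofReal_ne_zero.2 hy.ne'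
  have hφp : 0 < (φ p).im := hpos p (hpim ▸ hy)
  set q : ℂ → ℂ := fun ζ =>
    (φ (y * invCayley ζ) - φ p) / (φ (y * invCayley ζ) - conj (φ p)) with hq
  have hm : ∀ ζ : ℂ, ‖ζ‖ < 1 → 0 < ((y : ℂ) * invCayley ζ).im := fun ζ hζ => by
    rw [Complex.im_ofReal_mul]; exact mul_pos hy (invCayley_im_pos hζ)
  have hd : DifferentiableOn ℂ q (ball 0 1) := by
    have h1 : DifferentiableOn ℂ (fun ζ => φ (y * invCayley ζ)) (ball 0 1) := by
      refine hφ.comp (fun ζ hζ => DifferentiableAt.differentiableWithinAt ?_)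
        fun ζ hζ => hm ζ (by simpa using hζ)
      have : 1 - ζ ≠ 0 := by
        simpa using one_sub_mul_conj_ne_zero (ζ := ζ) (w := 1) (by simpa using hζ) (by simp)
      unfold invCayley
      fun_prop (disch := exact this)
    exact (h1.sub_const _).div (h1.sub_const _) fun ζ hζ =>
      sub_conj_ne_zero (hpos _ (hm ζ (by simpa using hζ))) hφp
  have hmaps : MapsTo q (ball 0 1) (closedBall 0 1) := by
    intro ζ hζ
    have h1 := hpos _ (hm ζ (by simpa using hζ))
    rw [mem_closedBall_zero_iff, hq, norm_div]
    refine div_le_one_of_le₀ ?_ (norm_nonneg _)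
    rw [← sq_le_sq₀ (norm_nonneg _) (norm_nonneg _), ← Complex.normSq_eq_norm_sq,
      ← Complex.normSq_eq_norm_sq, normSq_sub_conj]
    have := mul_pos h1 hφp
    linarith
  have hq0 : q 0 = 0 := by simp [hq, invCayley_zero, hp]
  have hwy : 0 < (w / y).im := by
    rw [Complex.div_ofReal_im]; exact div_pos hw hy
  have h := Complex.norm_le_norm_of_mapsTo_ball hd hmaps hq0 (norm_cayley_lt_one hwy)
  have hcay : cayley (w / y) = (w - p) / (w - conj p) := by
    have h1 := sub_conj_ne_zero hw (hpim.symm ▸ hy)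
    have h2 := add_I_ne_zero hwy
    rw [cayley, div_eq_div_iff h2 h1]
    simp only [hp, map_mul, Complex.conj_I, Complex.conj_ofReal]
    field_simp
    ring
  simp only [hq, invCayley_cayley (add_I_ne_zero hwy), mul_div_cancel₀ _ hyc] at h
  rw [hcay, norm_div, norm_div,
    div_le_div_iff₀ (norm_pos_iff.2 (sub_conj_ne_zero (hpos w hw) hφp))
    (norm_pos_iff.2 (sub_conj_ne_zero hw (hpim.symm ▸ hy)))] at h
  have h2 := mul_self_le_mul_self (by positivity) h
  have h3 : Complex.normSq (φ w - φ p) * Complex.normSq (w - conj p) ≤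
      Complex.normSq (w - p) * Complex.normSq (φ w - conj (φ p)) := by
    simp only [Complex.normSq_eq_norm_sq]
    linarith
  rw [normSq_sub_conj, normSq_sub_conj, hpim] at h3
  linarith

/-- A holomorphic self-map of the half-plane whose angular derivative at infinity is `d` has
imaginary part at least `d * Im w`. -/
lemma mul_im_le_of_tendsto {φ : ℂ → ℂ} (hφ : DifferentiableOn ℂ φ {z | 0 < z.im})
    (hnn : ∀ z : ℂ, 0 < z.im → 0 ≤ (φ z).im) {d : ℝ} (hd : 0 ≤ d)
    (hlim : Tendsto (fun y : ℝ => φ (y * Complex.I) / (y * Complex.I)) atTop (𝓝 d))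
    {w : ℂ} (hw : 0 < w.im) : d * w.im ≤ (φ w).im := by
  rcases hd.eq_or_lt with rfl | hd
  · simpa using hnn w hw
  -- the Schwarz–Pick inequality needs a positive imaginary part
  refine le_of_forall_pos_le_add fun ε hε => ?_
  set ψ : ℂ → ℂ := fun z => φ z + ε * Complex.I with hψ
  have hψd : DifferentiableOn ℂ ψ {z | 0 < z.im} := hφ.add_const _
  have hψpos : ∀ z : ℂ, 0 < z.im → 0 < (ψ z).im := fun z hz => by
    have := hnn z hz
    simp [hψ]; linarith
  have hinv : Tendsto (fun y : ℝ => ((y : ℂ))⁻¹) atTop (𝓝 0) := by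
    have := (Complex.continuous_ofReal.tendsto 0).comp tendsto_inv_atTop_zero
    simpa [Function.comp_def] using this
  have hψlim : Tendsto (fun y : ℝ => ψ (y * Complex.I) / (y * Complex.I)) atTop (𝓝 d) := by
    have h := hlim.add (hinv.const_mul (ε : ℂ))
    rw [mul_zero, add_zero] at h
    refine h.congr' ?_
    filter_upwards [eventually_gt_atTop 0] with y hy
    have : (y : ℂ) ≠ 0 := Complex.ofReal_ne_zero.2 hy.ne'
    have := Complex.I_ne_zero
    simp only [hψ]
    field_simp
  have hψlim' : Tendsto (fun y : ℝ => ψ (y * Complex.I) / y) atTop (𝓝 (d * Complex.I)) := by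
    refine (hψlim.mul_const Complex.I).congr' ?_
    filter_upwards [eventually_gt_atTop 0] with y hy
    have : (y : ℂ) ≠ 0 := Complex.ofReal_ne_zero.2 hy.ne'
    have := Complex.I_ne_zero
    field_simp
  have l1 : Tendsto (fun y : ℝ => Complex.normSq (ψ w / y - ψ (y * Complex.I) / y) * w.im) atTop
      (𝓝 (d ^ 2 * w.im)) := by
    have h := ((Complex.continuous_normSq.tendsto _).comp
      ((hinv.const_mul (ψ w)).sub hψlim')).mul_const w.im
    have e : Complex.normSq (ψ w * 0 - d * Complex.I) = d ^ 2 := by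
      simp [Complex.normSq_apply, sq]
    rw [e] at h
    exact h
  have l2 : Tendsto (fun y : ℝ => (ψ w).im * (ψ (y * Complex.I) / y).im *
      Complex.normSq (w / y - Complex.I)) atTop (𝓝 ((ψ w).im * d * 1)) := by
    have h1 := ((Complex.continuous_im.tendsto _).comp hψlim').const_mul (ψ w).im
    have h2 := (Complex.continuous_normSq.tendsto _).comp
      ((hinv.const_mul w).sub_const Complex.I)
    have h := h1.mul h2
    have e : Complex.normSq (w * 0 - Complex.I) = 1 := by simp
    have e' : ((d : ℂ) * Complex.I).im = d := by simp
    rw [e, e'] at h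
    exact h
  have hle : d ^ 2 * w.im ≤ (ψ w).im * d * 1 := by
    refine le_of_tendsto_of_tendsto l1 l2 ?_
    filter_upwards [eventually_gt_atTop 0] with y hy
    have hyc : (y : ℂ) ≠ 0 := Complex.ofReal_ne_zero.2 hy.ne'
    have h := schwarz_pick hψd hψpos hw hy
    have e1 : ψ w / y - ψ (y * Complex.I) / y = (ψ w - ψ (y * Complex.I)) / y := by ring
    have e2 : w / y - Complex.I = (w - y * Complex.I) / y := by field_simp
    rw [e1, e2, Complex.normSq_div, Complex.normSq_div, Complex.div_ofReal_im,
      Complex.normSq_ofReal]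
    have : 0 < y * y * y := by positivity
    rw [← mul_le_mul_iff_left₀ this]
    calc _ = Complex.normSq (ψ w - ψ (y * Complex.I)) * (w.im * y) := by field_simp
      _ ≤ _ := h
      _ = _ := by field_simp
  have : (ψ w).im = (φ w).im + ε := by simp [hψ]
  rw [← this]
  nlinarith

lemma TendstoUpper.tendsto_mul_I {φ : ℂ → ℂ} {l : ℂ} (h : TendstoUpper φ l) :
    Tendsto (fun y : ℝ => φ (y * Complex.I)) atTop (𝓝 l) := by
  refine (h (Real.pi / 2) (by positivity) le_rfl).comp (tendsto_inf.2 ⟨?_, tendsto_principal.2 ?_⟩)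
  · rw [← tendsto_norm_atTop_iff_cobounded]
    refine tendsto_id.congr' ?_
    filter_upwards [eventually_gt_atTop 0] with y hy
    simp [abs_of_pos hy]
  · filter_upwards [eventually_gt_atTop 0] with y hy
    have : ((y : ℂ) * Complex.I).arg = Real.pi / 2 := by
      rw [Complex.arg_real_mul _ hy, Complex.arg_I]
    refine ⟨by simpa using hy, this.ge, ?_⟩
    rw [this]; linarith [Real.pi_pos]

lemma update_mem_polyUpper {z : Fin n → ℂ} (hz : z ∈ polyUpper n) (j : Fin n) {w : ℂ}
    (hw : 0 < w.im) : Function.update z j w ∈ polyUpper n := by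
  intro k
  by_cases hk : k = j
  · subst hk; simpa using hw
  · simpa [hk] using hz k

lemma polyUpper_subset_polyCut : polyUpper n ⊆ polyCut n := fun _ hz j => (hz j).ne'

lemma I_mem_polyUpper : (fun _ => Complex.I) ∈ polyUpper n := fun _ => by simp

lemma differentiableOn_update {f : (Fin n → ℂ) → ℂ} (hf : DifferentiableOn ℂ f (polyUpper n))
    {z : Fin n → ℂ} (hz : z ∈ polyUpper n) (j : Fin n) :
    DifferentiableOn ℂ (fun w => f (Function.update z j w)) {w | 0 < w.im} :=
  hf.comp (fun w _ => (hasFDerivAt_update z w).differentiableAt.differentiableWithinAt)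
    fun _ hw => update_mem_polyUpper hz j hw

lemma tendsto_const_div_mul_I (c : ℂ) :
    Tendsto (fun y : ℝ => c / (y * Complex.I)) atTop (𝓝 0) := by
  have h1 := ((Complex.continuous_ofReal.tendsto 0).comp
    tendsto_inv_atTop_zero).const_mul (c / Complex.I)
  rw [Complex.ofReal_zero, mul_zero] at h1
  refine h1.congr fun y => ?_
  simp only [Function.comp_apply, Complex.ofReal_inv, div_eq_mul_inv, mul_inv]
  ring

/-- Subtracting the linear part of a Herglotz–Nevanlinna function, one variable at a time, leaves a
function with non-negative imaginary part. -/
lemma im_sub_linear_nonneg {f : (Fin n → ℂ) → ℂ} {d : Fin n → ℝ}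
    (hf : DifferentiableOn ℂ f (polyUpper n)) (hd : ∀ j, 0 ≤ d j)
    (hupper : ∀ j, ∀ z ∈ polyUpper n, Tendsto
      (fun y : ℝ => f (Function.update z j (y * Complex.I)) / (y * Complex.I)) atTop (𝓝 (d j)))
    (him : ∀ z ∈ polyUpper n, 0 ≤ (f z).im) (S : Finset (Fin n)) :
    ∀ z ∈ polyUpper n, 0 ≤ (f z - ∑ j ∈ S, (d j : ℂ) * z j).im := by
  induction S using Finset.induction_on with
  | empty => simpa using him
  | insert j S hj ih =>
    intro z hz
    set c : ℂ := ∑ k ∈ S, (d k : ℂ) * z k with hc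
    have hsum : ∀ w : ℂ, ∑ k ∈ S, (d k : ℂ) * Function.update z j w k = c := by
      intro w
      refine Finset.sum_congr rfl fun k hk => ?_
      rw [Function.update_of_ne (by rintro rfl; exact hj hk)]
    have h := mul_im_le_of_tendsto (φ := fun w => f (Function.update z j w) - c)
      ((differentiableOn_update hf hz j).sub_const c) (fun w hw => by
        simpa only [hsum] using ih _ (update_mem_polyUpper hz j hw)) (hd j) (by
        have h2 := (hupper j z hz).sub (tendsto_const_div_mul_I c)
        rw [sub_zero] at h2
        exact h2.congr fun y => (sub_div _ _ _).symm) (hz j)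
    rw [Function.update_eq_self] at h
    rw [Finset.sum_insert hj, ← hc]
    simp only [Complex.sub_im, Complex.add_im, Complex.im_ofReal_mul] at h ⊢
    linarith

/-! ### Integrability under the growth condition -/

/-- Continuous functions bounded by a multiple of the density `1 / (1 + t²)`. -/
def CauchyDominated (φ : ℝ → ℂ) : Prop :=
  Continuous φ ∧ ∃ C : ℝ, ∀ t, ‖φ t‖ ≤ C * cauchyWeight t

lemma CauchyDominated.add {φ ψ : ℝ → ℂ} (hφ : CauchyDominated φ) (hψ : CauchyDominated ψ) :
    CauchyDominated fun t => φ t + ψ t := by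
  obtain ⟨hc, C, hC⟩ := hφ
  obtain ⟨hc', C', hC'⟩ := hψ
  refine ⟨hc.add hc', C + C', fun t => (norm_add_le _ _).trans ?_⟩
  rw [add_mul]
  exact add_le_add (hC t) (hC' t)

lemma CauchyDominated.neg {φ : ℝ → ℂ} (hφ : CauchyDominated φ) :
    CauchyDominated fun t => -φ t := by
  obtain ⟨hc, C, hC⟩ := hφ
  exact ⟨hc.neg, C, fun t => (norm_neg _).trans_le (hC t)⟩

lemma cauchyDominated_cauchyWeight : CauchyDominated fun t => (cauchyWeight t : ℂ) :=
  ⟨Complex.continuous_ofReal.comp continuous_cauchyWeight, 1, fun t => by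
    rw [Complex.norm_real, Real.norm_of_nonneg (cauchyWeight_pos t).le, one_mul]⟩

lemma cauchyDominated_halfPlaneFactor {z : ℂ} (hz : z.im ≠ 0) :
    CauchyDominated (halfPlaneFactor z) := by
  refine ⟨continuous_halfPlaneFactor hz,
    ‖z + Complex.I‖ / 2 * (1 + ‖z - Complex.I‖ / |z.im|), fun t => ?_⟩
  rw [halfPlaneFactor_eq hz, norm_mul, Complex.norm_real,
    Real.norm_of_nonneg (cauchyWeight_pos t).le, mul_comm]
  exact mul_le_mul_of_nonneg_right (norm_factorRatio_le hz t) (cauchyWeight_pos t).le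

lemma cauchyDominated_nFactor {z : ℂ} (hz : z.im ≠ 0) (σ : SignType) :
    CauchyDominated (nFactor σ z) := by
  cases σ
  · rw [show nFactor SignType.zero z = _ from funext (nFactor_zero z)]
    exact cauchyDominated_cauchyWeight
  · rw [show nFactor SignType.neg z = _ from funext (nFactor_neg z)]
    simp only [sub_eq_add_neg]
    exact (cauchyDominated_halfPlaneFactor hz).add cauchyDominated_cauchyWeight.neg
  · rw [show nFactor SignType.pos z = _ from funext (nFactor_pos z)]
    exact (cauchyDominated_halfPlaneFactor (by simpa)).neg

variable {μ : Measure (Fin n → ℝ)}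

lemma integrable_prod_cauchyWeight (hμ : GrowthCondition μ) :
    Integrable (fun t : Fin n → ℝ => ∏ j, cauchyWeight (t j)) μ := by
  refine ⟨continuous_prod_cauchyWeight.aestronglyMeasurable, ?_⟩
  rw [hasFiniteIntegral_iff_ofReal (.of_forall fun t => (prod_cauchyWeight_pos t).le)]
  exact hμ

lemma integrable_prod (hμ : GrowthCondition μ) {φ : Fin n → ℝ → ℂ}
    (hφ : ∀ j, CauchyDominated (φ j)) : Integrable (fun t => ∏ j, φ j (t j)) μ := by
  choose hc C hC using hφ
  refine ((integrable_prod_cauchyWeight hμ).const_mul (∏ j, C j)).mono'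
    (continuous_finsetProd _ fun j _ => (hc j).comp (continuous_apply j)).aestronglyMeasurable
    (.of_forall fun t => ?_)
  rw [norm_prod, ← Finset.prod_mul_distrib]
  exact Finset.prod_le_prod (fun j _ => norm_nonneg _) fun j _ => hC j (t j)

lemma integrable_prod_halfPlaneFactor (hμ : GrowthCondition μ) {z : Fin n → ℂ}
    (hz : z ∈ polyCut n) : Integrable (fun t => ∏ j, halfPlaneFactor (z j) (t j)) μ :=
  integrable_prod hμ fun j => cauchyDominated_halfPlaneFactor (hz j)

lemma integrable_kernel (hμ : GrowthCondition μ) {z : Fin n → ℂ} (hz : z ∈ polyCut n) :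
    Integrable (kernel z) μ := by
  rw [funext (kernel_eq z)]
  exact (((integrable_prod_halfPlaneFactor hμ hz).const_mul 2).sub
    (integrable_prod_cauchyWeight hμ).ofReal).const_mul _

/-! ### The symmetry formula -/

lemma sum_neg_one_pow_card_mul_prod_piecewise (f g : Fin n → ℂ) :
    ∑ B : Finset (Fin n), (-1 : ℂ) ^ B.card * ∏ l, B.piecewise f g l = ∏ l, (g l - f l) := by
  have h := Finset.prod_add (fun l => - f l) g Finset.univ
  rw [Finset.powerset_univ] at h
  simp only [neg_add_eq_sub] at h
  rw [h]
  refine Finset.sum_congr rfl fun B _ => ?_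
  rw [Finset.prod_piecewise, Finset.univ_inter, Finset.prod_neg, mul_assoc]

lemma sum_neg_one_pow_card (hn : 1 ≤ n) : ∑ B : Finset (Fin n), (-1 : ℂ) ^ B.card = 0 := by
  have h := sum_neg_one_pow_card_mul_prod_piecewise (n := n) 1 1
  simp only [Finset.piecewise_same, Pi.one_apply, Finset.prod_const_one, mul_one, sub_self,
    Finset.prod_const, Finset.card_univ, Fintype.card_fin] at h
  rw [h, zero_pow (by omega)]

lemma sum_nonempty_eq (X : Finset (Fin n) → ℂ) :
    ∑ B : Finset (Fin n) with B.Nonempty, (-1 : ℂ) ^ (B.card + 1) * X B =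
      X ∅ - ∑ B : Finset (Fin n), (-1 : ℂ) ^ B.card * X B := by
  have h : (Finset.univ.filter fun B : Finset (Fin n) => B.Nonempty) = Finset.univ.erase ∅ := by
    ext B; simp [Finset.nonempty_iff_ne_empty]
  rw [h, ← Finset.add_sum_erase _ (fun B => (-1 : ℂ) ^ B.card * X B) (Finset.mem_univ ∅)]
  simp [pow_succ]

lemma selConj_mem_polyCut {z : Fin n → ℂ} (hz : z ∈ polyCut n) (B : Finset (Fin n)) :
    selConj B (fun _ => Complex.I) z ∈ polyCut n := by
  intro j
  by_cases hj : j ∈ B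
  · simpa [selConj, hj] using hz j
  · simp [selConj, hj]

lemma conj_kernel_selConj (B : Finset (Fin n)) (z : Fin n → ℂ) (t : Fin n → ℝ) :
    conj (kernel (selConj B (fun _ => Complex.I) z) t) =
      -Complex.I * (2 * ∏ l, B.piecewise (fun l => cauchyWeight (t l) - halfPlaneFactor (z l) (t l))
        (fun l => (cauchyWeight (t l) : ℂ)) l - ((∏ l, cauchyWeight (t l) : ℝ) : ℂ)) := by
  rw [kernel_eq, map_mul, map_sub, map_mul, Complex.conj_I, Complex.conj_ofReal, map_prod,
    map_ofNat]
  congr 4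
  funext l
  by_cases hl : l ∈ B
  · rw [Finset.piecewise_eq_of_mem _ _ _ hl, ← conj_halfPlaneFactor_conj]
    simp [selConj, hl]
  · rw [Finset.piecewise_eq_of_notMem _ _ _ hl, ← halfPlaneFactor_I]
    simp only [selConj, hl, if_false]
    rw [halfPlaneFactor_I, Complex.conj_ofReal]

/-- The kernel satisfies the symmetry formula pointwise in `t`. -/
lemma kernel_symmetry (hn : 1 ≤ n) (z : Fin n → ℂ) (t : Fin n → ℝ) :
    kernel z t = ∑ B : Finset (Fin n) with B.Nonempty,
      (-1 : ℂ) ^ (B.card + 1) * conj (kernel (selConj B (fun _ => Complex.I) z) t) := by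
  rw [sum_nonempty_eq fun B => conj (kernel (selConj B (fun _ => Complex.I) z) t)]
  simp only [conj_kernel_selConj]
  have h1 := sum_neg_one_pow_card_mul_prod_piecewise
    (fun l => cauchyWeight (t l) - halfPlaneFactor (z l) (t l)) fun l => (cauchyWeight (t l) : ℂ)
  have h2 := sum_neg_one_pow_card (n := n) hn
  simp only [sub_sub_cancel] at h1
  have h3 : ∑ B : Finset (Fin n), (-1 : ℂ) ^ B.card *
      (-Complex.I * (2 * ∏ l, B.piecewise
        (fun l => cauchyWeight (t l) - halfPlaneFactor (z l) (t l)) (fun l => (cauchyWeight (t l) : ℂ)) l -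
          ((∏ l, cauchyWeight (t l) : ℝ) : ℂ))) =
      -2 * Complex.I * ∏ l, halfPlaneFactor (z l) (t l) := by
    rw [← h1, Finset.mul_sum]
    have : ∑ B : Finset (Fin n), Complex.I * ((∏ l, cauchyWeight (t l) : ℝ) : ℂ) *
        (-1 : ℂ) ^ B.card = 0 := by rw [← Finset.mul_sum, h2, mul_zero]
    rw [← add_zero (∑ B : Finset (Fin n), -2 * Complex.I * _), ← this, ← Finset.sum_add_distrib]
    refine Finset.sum_congr rfl fun B _ => ?_
    ring
  rw [h3, kernel_eq, Finset.piecewise_empty]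
  push_cast
  ring

lemma symmetryFormula_integralFormula (hn : 1 ≤ n) (hμ : GrowthCondition μ) (a : ℝ) :
    SymmetryFormula (integralFormula a (0 : Fin n → ℝ) μ) := by
  intro z hz
  have h1 : ∫ t, kernel z t ∂μ = ∑ B : Finset (Fin n) with B.Nonempty,
      (-1 : ℂ) ^ (B.card + 1) *
        conj (∫ t, kernel (selConj B (fun _ => Complex.I) z) t ∂μ) := by
    rw [integral_congr_ae (.of_forall fun t => kernel_symmetry hn z t), integral_finsetSum]
    · refine Finset.sum_congr rfl fun B _ => ?_
      rw [integral_const_mul, integral_conj]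
    · intro B _
      have hi := integrable_kernel hμ (selConj_mem_polyCut hz B)
      exact (Complex.conjCLE.toContinuousLinearMap.integrable_comp hi).const_mul _
  have h2 : ∑ B : Finset (Fin n) with B.Nonempty, (-1 : ℂ) ^ (B.card + 1) * (a : ℂ) = a := by
    rw [sum_nonempty_eq fun _ => (a : ℂ), ← Finset.sum_mul, sum_neg_one_pow_card hn, zero_mul,
      sub_zero]
  simp only [integralFormula, Pi.zero_apply, Complex.ofReal_zero, zero_mul, Finset.sum_const_zero,
    add_zero]
  rw [h1, ← h2, Finset.mul_sum, ← Finset.sum_add_distrib, h2]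
  refine Finset.sum_congr rfl fun B _ => ?_
  rw [map_add, map_mul, map_div₀, map_pow, Complex.conj_ofReal, Complex.conj_ofReal, map_one]
  ring

/-! ### Uniqueness of the symmetric extension -/

lemma selConj_mem_polyUpper {z : Fin n → ℂ} {B : Finset (Fin n)}
    (hB : ∀ j ∈ B, (z j).im < 0) : selConj B (fun _ => Complex.I) z ∈ polyUpper n := by
  intro j
  by_cases hj : j ∈ B
  · simpa [selConj, hj] using hB j hj
  · simp [selConj, hj]

/-- A function with the symmetry and non-dependence properties that vanishes on the poly-upper
half-plane vanishes everywhere. At a point `z` with `Im zₐ < 0`, the terms of the symmetry formula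
belonging to `B` and to `B ∪ {a}` or `B ∖ {a}` cancel. -/
lemma eq_zero_of_symmetry {D : (Fin n → ℂ) → ℂ} (hs : SymmetryFormula D)
    (hv : VariableNonDependence D) (h0 : ∀ z ∈ polyUpper n, D z = 0) :
    ∀ z ∈ polyCut n, D z = 0 := by
  intro z hz
  by_cases hup : z ∈ polyUpper n
  · exact h0 z hup
  obtain ⟨a, ha⟩ : ∃ a, (z a).im < 0 := by
    by_contra hcon
    push Not at hcon
    exact hup fun j => lt_of_le_of_ne (hcon j) (hz j).symm
  set T : Finset (Fin n) → ℂ := fun B => conj (D (selConj B (fun _ => Complex.I) z)) with hT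
  have hTsub : ∀ B : Finset (Fin n), (∀ j ∈ B, (z j).im < 0) → T B = 0 := fun B hB => by
    simp only [hT, h0 _ (selConj_mem_polyUpper hB), map_zero]
  have hTins : ∀ B : Finset (Fin n), a ∉ B → T (insert a B) = T B := by
    intro B haB
    by_cases hB : ∀ j ∈ B, (z j).im < 0
    · rw [hTsub B hB, hTsub]
      intro j hj
      rcases Finset.mem_insert.1 hj with rfl | hj
      exacts [ha, hB j hj]
    · push Not at hB
      obtain ⟨k, hkB, hk⟩ := hB
      have hk' : 0 < (z k).im := lt_of_le_of_ne hk (hz k).symm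
      have key : ∀ j, j ≠ a → selConj B (fun _ => Complex.I) z j =
          selConj (insert a B) (fun _ => Complex.I) z j := by
        intro j hj
        simp [selConj, hj]
      have hap : 0 < (selConj (insert a B) (fun _ => Complex.I) z a).im := by
        simpa [selConj] using ha
      simp only [hT]
      congr 1
      refine hv _ (selConj_mem_polyCut hz _) _ (selConj_mem_polyCut hz _) ⟨k, ?_⟩ ?_ ?_
      · simpa [selConj, hkB] using hk'
      · intro j hj
        refine key j ?_
        rintro rfl
        exact lt_asymm hap hj
      · intro j hj
        by_cases hja : j = a
        · subst hja; simp [selConj, haB]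
        · rwa [key j hja]
  rw [hs z hz]
  change ∑ B : Finset (Fin n) with B.Nonempty, (-1 : ℂ) ^ (B.card + 1) * T B = 0
  rw [sum_nonempty_eq, hTsub ∅ (by simp), zero_sub, neg_eq_zero]
  refine Finset.sum_involution (fun B _ => if a ∈ B then B.erase a else insert a B) ?_ ?_ ?_ ?_
  · intro B _
    by_cases haB : a ∈ B
    · have h := hTins (B.erase a) (Finset.notMem_erase a B)
      rw [Finset.insert_erase haB] at h
      have hc := Finset.card_erase_add_one haB
      simp only [haB, if_true, h, ← hc, pow_succ]
      ring
    · simp only [haB, if_false, hTins B haB, Finset.card_insert_of_notMem haB, pow_succ]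
      ring
  · intro B _ _ hB
    by_cases haB : a ∈ B
    · simp only [haB, if_true] at hB
      exact Finset.notMem_erase a B (hB.symm ▸ haB)
    · simp only [haB, if_false] at hB
      exact haB (hB ▸ Finset.mem_insert_self a B)
  · intro B _; exact Finset.mem_univ _
  · intro B _
    by_cases haB : a ∈ B <;> simp [haB]

/-! ### The Nevanlinna condition for individual indices -/

lemma isOpen_upper : IsOpen {w : ℂ | 0 < w.im} := isOpen_lt continuous_const Complex.continuous_im

/-- A function that is both holomorphic and antiholomorphic on the upper half-plane is constant. -/
lemma eq_of_differentiableOn_conj {H : ℂ → ℂ} (hH : DifferentiableOn ℂ H {w | 0 < w.im})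
    (hH' : DifferentiableOn ℂ (fun w => conj (H w)) {w | 0 < w.im}) {w : ℂ} (hw : 0 < w.im) :
    H w = H Complex.I := by
  have hconv : Convex ℝ {w : ℂ | 0 < w.im} := convex_halfSpace_im_gt 0
  refine isOpen_upper.is_const_of_deriv_eq_zero hconv.isPreconnected hH (fun x hx => ?_) hw
    (by simp)
  have h1 := ((hH x hx).differentiableAt (isOpen_upper.mem_nhds hx)).hasDerivAt
  have h2 := ((hH' x hx).differentiableAt (isOpen_upper.mem_nhds hx)).hasDerivAt
  -- compare the derivatives of `conj ∘ H` as a composition and as a holomorphic function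
  have h3 : HasFDerivAt (𝕜 := ℝ) (fun w => conj (H w)) _ x :=
    Complex.conjCLE.toContinuousLinearMap.hasFDerivAt.comp x (h1.hasFDerivAt.restrictScalars ℝ)
  have h4 := h3.unique (h2.hasFDerivAt.restrictScalars ℝ)
  have h5 := congrArg (fun L : ℂ →L[ℝ] ℂ => L 1) h4
  have h6 := congrArg (fun L : ℂ →L[ℝ] ℂ => L Complex.I) h4
  simp at h5 h6
  rw [← h5] at h6
  have h7 : conj (deriv H x) = 0 := by
    have := Complex.I_ne_zero
    have h8 : Complex.I * conj (deriv H x) = 0 := by linear_combination (-1 / 2 : ℂ) * h6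
    exact (mul_eq_zero.1 h8).resolve_left this
  simpa using h7

/-- If a sum of a holomorphic function, a constant and an antiholomorphic function vanishes on the
upper half-plane, and the two functions vanish at `I`, then every summand vanishes. -/
lemma separate {H A : ℂ → ℂ} {c : ℂ} (hH : DifferentiableOn ℂ H {w | 0 < w.im})
    (hA : DifferentiableOn ℂ (fun w => conj (A w)) {w | 0 < w.im}) (hHI : H Complex.I = 0)
    (hAI : A Complex.I = 0) (h : ∀ w : ℂ, 0 < w.im → H w + c + A w = 0) {w : ℂ} (hw : 0 < w.im) :
    H w = 0 ∧ c = 0 ∧ A w = 0 := by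
  have hc : c = 0 := by simpa [hHI, hAI] using h Complex.I (by simp)
  have hHA : ∀ w : ℂ, 0 < w.im → H w = -A w := fun w hw => by
    have := h w hw
    rw [hc, add_zero] at this
    exact eq_neg_of_add_eq_zero_left this
  have h0 : H w = 0 := by
    rw [← hHI]
    refine eq_of_differentiableOn_conj hH (hA.neg.congr fun x hx => ?_) hw
    rw [hHA x hx, map_neg]
    rfl
  exact ⟨h0, hc, by simpa [h0] using (hHA w hw).symm⟩

lemma hasDerivAt_nFactor_neg {w : ℂ} (hw : 0 < w.im) (t : ℝ) :
    HasDerivAt (fun w => nFactor SignType.neg w t)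
      (1 / (2 * Complex.I) * (1 / ((t : ℂ) - w) ^ 2)) w := by
  have h1 := ofReal_sub_ne_zero hw.ne' t
  have h := (((hasDerivAt_id w).const_sub (t : ℂ)).inv h1).sub_const
    (1 / ((t : ℂ) - Complex.I)) |>.const_mul (1 / (2 * Complex.I))
  refine (h.congr_deriv (by simp)).congr_of_eventuallyEq (.of_forall fun x => ?_)
  simp [nFactor]

/-- Off the real line, `|t - w|⁻²` is comparable to `1 / (1 + t²)`. -/
lemma norm_one_div_sub_sq_le {w : ℂ} (hw : 0 < w.im) (t : ℝ) :
    ‖1 / ((t : ℂ) - w) ^ 2‖ ≤ (1 + ‖w - Complex.I‖ / w.im) ^ 2 * cauchyWeight t := by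
  have h1 := ofReal_sub_ne_zero hw.ne' t
  have h3 := ofReal_sub_I_ne_zero t
  have e : (1 : ℂ) / (t - w) = (1 + (w - Complex.I) / (t - w)) * (1 / (t - Complex.I)) := by
    field_simp; ring
  have e2 : ‖(1 : ℂ) / (t - Complex.I)‖ ^ 2 = cauchyWeight t := by
    rw [norm_div, norm_one, div_pow, one_pow, ← Complex.normSq_eq_norm_sq, Complex.normSq_apply]
    simp [cauchyWeight, sq, add_comm]
  rw [← one_div_pow, norm_pow, e, norm_mul, mul_pow, e2]
  refine mul_le_mul_of_nonneg_right ?_ (cauchyWeight_pos t).le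
  refine pow_le_pow_left₀ (norm_nonneg _) ((norm_add_le _ _).trans ?_) 2
  rw [norm_one, norm_div]
  gcongr
  have := abs_im_le_norm_ofReal_sub w t
  rwa [abs_of_pos hw] at this

lemma differentiableOn_integral_nFactor (j : Fin n) {Q : (Fin n → ℝ) → ℂ} (hQ : Continuous Q)
    (hint : Integrable (fun t => (cauchyWeight (t j) : ℂ) * Q t) μ) :
    DifferentiableOn ℂ (fun w => ∫ t, nFactor SignType.neg w (t j) * Q t ∂μ) {w | 0 < w.im} := by
  intro w₀ hw₀
  have hw₀' : 0 < w₀.im := hw₀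
  refine DifferentiableAt.differentiableWithinAt ?_
  set C : ℝ := (1 + (‖w₀ - Complex.I‖ + w₀.im / 2) / (w₀.im / 2)) ^ 2 with hC
  have hball : ∀ w ∈ ball w₀ (w₀.im / 2), w₀.im / 2 ≤ w.im ∧
      ‖w - Complex.I‖ ≤ ‖w₀ - Complex.I‖ + w₀.im / 2 := by
    intro w hw
    rw [mem_ball, dist_eq_norm] at hw
    constructor
    · have := (Complex.abs_im_le_norm (w - w₀)).trans hw.le
      rw [Complex.sub_im, abs_le] at this
      linarith [this.1]
    · have := norm_add_le (w - w₀) (w₀ - Complex.I)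
      rw [sub_add_sub_cancel] at this
      linarith
  have hcont : ∀ w : ℂ, 0 < w.im →
      Continuous fun t : Fin n → ℝ => nFactor SignType.neg w (t j) * Q t := fun w hw =>
    ((continuous_nFactor hw _).comp (continuous_apply j)).mul hQ
  have key := hasDerivAt_integral_of_dominated_loc_of_deriv_le (𝕜 := ℂ) (μ := μ) (x₀ := w₀)
    (s := ball w₀ (w₀.im / 2))
    (F := fun w t => nFactor SignType.neg w (t j) * Q t)
    (F' := fun w t => 1 / (2 * Complex.I) * (1 / ((t j : ℂ) - w) ^ 2) * Q t)
    (bound := fun t => C * ‖(cauchyWeight (t j) : ℂ) * Q t‖)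
    (ball_mem_nhds w₀ (by positivity)) ?_ ?_ ?_ ?_ (hint.norm.const_mul C) ?_
  · exact key.2.differentiableAt
  · filter_upwards [isOpen_upper.mem_nhds hw₀] with w hw
    exact (hcont w hw).aestronglyMeasurable
  · obtain ⟨-, K, hK⟩ := cauchyDominated_nFactor hw₀'.ne' SignType.neg
    refine (hint.norm.const_mul K).mono' (hcont w₀ hw₀).aestronglyMeasurable
      (.of_forall fun t => ?_)
    rw [norm_mul, norm_mul, Complex.norm_real, Real.norm_of_nonneg (cauchyWeight_pos _).le,
      ← mul_assoc]
    exact mul_le_mul_of_nonneg_right (hK (t j)) (norm_nonneg _)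
  · refine (Continuous.mul ?_ hQ).aestronglyMeasurable
    refine continuous_const.mul (continuous_const.div (by fun_prop) fun t => ?_)
    exact pow_ne_zero _ (ofReal_sub_ne_zero hw₀'.ne' _)
  · refine .of_forall fun t w hw => ?_
    obtain ⟨h1, h2⟩ := hball w hw
    have hw0 : 0 < w.im := by linarith
    have hle : ‖1 / ((t j : ℂ) - w) ^ 2‖ ≤ C * cauchyWeight (t j) := by
      refine (norm_one_div_sub_sq_le hw0 (t j)).trans
        (mul_le_mul_of_nonneg_right ?_ (cauchyWeight_pos _).le)
      rw [hC]
      gcongr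
    have h3 : ‖(1 : ℂ) / (2 * Complex.I)‖ ≤ 1 := by simp; norm_num
    rw [norm_mul, norm_mul, norm_mul, Complex.norm_real,
      Real.norm_of_nonneg (cauchyWeight_pos _).le, ← mul_assoc]
    refine mul_le_mul_of_nonneg_right ?_ (norm_nonneg _)
    refine (mul_le_mul h3 hle (norm_nonneg _) zero_le_one).trans_eq (one_mul _)
  · refine .of_forall fun t w hw => ?_
    have hw0 : 0 < w.im := by linarith [(hball w hw).1]
    exact (hasDerivAt_nFactor_neg hw0 (t j)).mul_const _

/-- The integral in the Nevanlinna condition for the index `ρ`. -/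
def nIntegral (μ : Measure (Fin n → ℝ)) (ρ : Fin n → SignType) (z : Fin n → ℂ) : ℂ :=
  ∫ t, ∏ k, nFactor (ρ k) (z k) (t k) ∂μ

lemma prod_nFactor_update (ρ : Fin n → SignType) (z : Fin n → ℂ) (j : Fin n) (w : ℂ)
    (t : Fin n → ℝ) : ∏ k, nFactor (ρ k) (Function.update z j w k) (t k) =
      nFactor (ρ j) w (t j) * ∏ k ∈ Finset.univ.erase j, nFactor (ρ k) (z k) (t k) := by
  rw [← Finset.mul_prod_erase _ _ (Finset.mem_univ j), Function.update_self]
  congr 1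
  refine Finset.prod_congr rfl fun k hk => ?_
  rw [Function.update_of_ne (Finset.ne_of_mem_erase hk)]

lemma conj_nFactor (σ : SignType) (z : ℂ) (t : ℝ) : conj (nFactor σ z t) = nFactor (-σ) z t := by
  cases σ
  · change conj (nFactor SignType.zero z t) = nFactor SignType.zero z t
    rw [nFactor_zero, Complex.conj_ofReal]
  · exact (nFactor_pos_eq_conj z t).symm
  · change conj (nFactor SignType.pos z t) = nFactor SignType.neg z t
    rw [nFactor_pos_eq_conj, Complex.conj_conj]

lemma conj_nIntegral (ρ : Fin n → SignType) (z : Fin n → ℂ) :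
    conj (nIntegral μ ρ z) = nIntegral μ (-ρ) z := by
  simp only [nIntegral, ← integral_conj, map_prod, conj_nFactor, Pi.neg_apply]

lemma differentiableOn_nIntegral (hμ : GrowthCondition μ) {ρ : Fin n → SignType} {z : Fin n → ℂ}
    (hz : z ∈ polyUpper n) {j : Fin n} (hj : ρ j = -1) :
    DifferentiableOn ℂ (fun w => nIntegral μ ρ (Function.update z j w)) {w | 0 < w.im} := by
  have hj' : ρ j = SignType.neg := hj
  simp only [nIntegral, prod_nFactor_update, hj']
  refine differentiableOn_integral_nFactor j (continuous_finsetProd _ fun k _ =>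
    (continuous_nFactor (hz k) (ρ k)).comp (continuous_apply k)) ?_
  have h := integrable_prod hμ (φ := fun k => nFactor (Function.update ρ j 0 k) (z k))
    fun k => cauchyDominated_nFactor (hz k).ne' _
  refine h.congr (.of_forall fun t => ?_)
  simp only
  rw [← Finset.mul_prod_erase _ _ (Finset.mem_univ j), Function.update_self]
  congr 1
  · exact nFactor_zero _ _
  · refine Finset.prod_congr rfl fun k hk => ?_
    rw [Function.update_of_ne (Finset.ne_of_mem_erase hk)]

lemma nFactor_neg_I (t : ℝ) : nFactor SignType.neg Complex.I t = 0 := by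
  rw [nFactor_neg, halfPlaneFactor_I, sub_self]

lemma nFactor_I_eq_zero {σ : SignType} (hσ : σ ≠ 0) (t : ℝ) : nFactor σ Complex.I t = 0 := by
  cases σ
  · exact absurd rfl hσ
  · exact nFactor_neg_I t
  · rw [nFactor_pos_eq_conj, nFactor_neg_I, map_zero]

lemma nIntegral_update_I {ρ : Fin n → SignType} (z : Fin n → ℂ) {j : Fin n} (hj : ρ j ≠ 0) :
    nIntegral μ ρ (Function.update z j Complex.I) = 0 := by
  simp only [nIntegral, prod_nFactor_update, nFactor_I_eq_zero hj, zero_mul, integral_zero]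

lemma nIntegral_update_of_zero {ρ : Fin n → SignType} (z : Fin n → ℂ) {j : Fin n} (hj : ρ j = 0)
    (w : ℂ) : nIntegral μ ρ (Function.update z j w) = nIntegral μ ρ z := by
  have hj' : ρ j = SignType.zero := hj
  have h := fun t => prod_nFactor_update ρ z j (z j) t
  rw [Function.update_eq_self] at h
  simp only [nIntegral, prod_nFactor_update, h, hj']
  rfl

/-- Under the Nevanlinna condition, each of the integrals in it vanishes separately: the sums over
the indices `ρ` with `ρ j` equal to `-1`, `0` and `1` are respectively holomorphic, constant and
antiholomorphic in the variable `z j`, so they can be separated one variable at a time. -/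
lemma nIntegral_eq_zero (hμ : GrowthCondition μ) (hN : NevanlinnaCondition μ)
    {ρ₀ : Fin n → SignType} (h1 : ∃ j, ρ₀ j = -1) (h2 : ∃ j, ρ₀ j = 1) {z : Fin n → ℂ}
    (hz : z ∈ polyUpper n) : nIntegral μ ρ₀ z = 0 := by
  set M : Finset (Fin n → SignType) :=
    Finset.univ.filter fun ρ => (∃ j, ρ j = -1) ∧ (∃ j, ρ j = 1) with hM
  have key : ∀ S : Finset (Fin n), ∀ z ∈ polyUpper n,
      ∑ ρ ∈ M.filter fun ρ => ∀ k ∈ S, ρ k = ρ₀ k, nIntegral μ ρ z = 0 := by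
    intro S
    induction S using Finset.induction_on with
    | empty =>
      intro z hz
      simpa [hM, nIntegral] using hN z hz
    | insert j S hj ih =>
      intro z hz
      set T := M.filter fun ρ => ∀ k ∈ S, ρ k = ρ₀ k with hT
      have hsplit : ∀ w : Fin n → ℂ, ∑ ρ ∈ T, nIntegral μ ρ w =
          ∑ ρ ∈ T with ρ j = -1, nIntegral μ ρ w + ∑ ρ ∈ T with ρ j = 0, nIntegral μ ρ w +
            ∑ ρ ∈ T with ρ j = 1, nIntegral μ ρ w := by
        intro w
        rw [← Finset.sum_fiberwise T (fun ρ => ρ j), SignType.univ_eq]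
        rw [Finset.sum_insert (by decide), Finset.sum_insert (by decide), Finset.sum_singleton]
        ring
      have hsep := separate (w := z j)
        (H := fun w => ∑ ρ ∈ T with ρ j = -1, nIntegral μ ρ (Function.update z j w))
        (A := fun w => ∑ ρ ∈ T with ρ j = 1, nIntegral μ ρ (Function.update z j w))
        (c := ∑ ρ ∈ T with ρ j = 0, nIntegral μ ρ z)
        (DifferentiableOn.fun_sum fun ρ hρ =>
          differentiableOn_nIntegral hμ hz (Finset.mem_filter.1 hρ).2)
        (by
          simp only [map_sum, conj_nIntegral]
          refine DifferentiableOn.fun_sum fun ρ hρ => differentiableOn_nIntegral hμ hz ?_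
          rw [Pi.neg_apply, (Finset.mem_filter.1 hρ).2])
        (Finset.sum_eq_zero fun ρ hρ => nIntegral_update_I z (by
          rw [(Finset.mem_filter.1 hρ).2]; decide))
        (Finset.sum_eq_zero fun ρ hρ => nIntegral_update_I z (by
          rw [(Finset.mem_filter.1 hρ).2]; decide))
        (fun w hw => by
          have h := ih _ (update_mem_polyUpper hz j hw)
          rw [hsplit] at h
          rw [← h]
          congr 2
          exact Finset.sum_congr rfl fun ρ hρ =>
            (nIntegral_update_of_zero z (Finset.mem_filter.1 hρ).2 w).symm) (hz j)
      rw [Function.update_eq_self] at hsep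
      have hfil : (M.filter fun ρ => ∀ k ∈ insert j S, ρ k = ρ₀ k) =
          T.filter fun ρ => ρ j = ρ₀ j := by
        ext ρ
        simp only [hT, Finset.mem_filter, Finset.forall_mem_insert]
        tauto
      rw [hfil]
      rcases hσ : ρ₀ j with _ | _ | _
      exacts [hsep.2.1, hsep.1, hsep.2.2]
  have h := key Finset.univ z hz
  have hfil : (M.filter fun ρ => ∀ k ∈ (Finset.univ : Finset (Fin n)), ρ k = ρ₀ k) = {ρ₀} := by
    ext ρ
    simp only [hM, Finset.mem_filter, Finset.mem_univ, true_and, forall_const,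
      Finset.mem_singleton, funext_iff]
    exact ⟨fun h => h.2, fun h => ⟨by rw [funext h]; exact ⟨h1, h2⟩, h⟩⟩
  rwa [hfil, Finset.sum_singleton] at h

/-! ### The non-dependence property -/

/-- If some component of `z` lies in the lower half-plane, those in the upper half-plane may be
replaced by `I` in the integral of the first product of the kernel: the difference is a sum of
integrals of mixed sign. -/
lemma integral_prod_halfPlaneFactor_eq (hμ : GrowthCondition μ) (hN : NevanlinnaCondition μ)
    {z : Fin n → ℂ} (hz : z ∈ polyCut n) (hlow : ∃ j, (z j).im < 0) :
    ∫ t, ∏ j, halfPlaneFactor (z j) (t j) ∂μ =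
      ∫ t, ∏ j, halfPlaneFactor (if (z j).im < 0 then z j else Complex.I) (t j) ∂μ := by
  set z' : Fin n → ℂ := fun j => if (z j).im < 0 then z j else Complex.I with hz'
  have hz'c : z' ∈ polyCut n := fun j => by
    by_cases h : (z j).im < 0
    · simpa [hz', h] using h.ne
    · simp [hz', h]
  -- the difference of the two factors vanishes in the lower half-plane
  set δ : Fin n → ℝ → ℂ := fun j t => halfPlaneFactor (z j) t - halfPlaneFactor (z' j) t with hδ
  have hδd : ∀ j, CauchyDominated (δ j) := fun j => by
    simp only [hδ, sub_eq_add_neg]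
    exact (cauchyDominated_halfPlaneFactor (hz j)).add
      (cauchyDominated_halfPlaneFactor (hz'c j)).neg
  have hexp : ∀ t : Fin n → ℝ, ∏ j, halfPlaneFactor (z j) (t j) =
      ∑ B : Finset (Fin n), ∏ j, B.piecewise δ (fun j => halfPlaneFactor (z' j)) j (t j) := by
    intro t
    have h := Finset.prod_add (fun j => δ j (t j)) (fun j => halfPlaneFactor (z' j) (t j))
      Finset.univ
    simp only [hδ, sub_add_cancel] at h
    rw [h, Finset.powerset_univ]
    refine Finset.sum_congr rfl fun B _ => ?_
    have e : ∀ j, B.piecewise δ (fun j => halfPlaneFactor (z' j)) j (t j) =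
        B.piecewise (fun j => δ j (t j)) (fun j => halfPlaneFactor (z' j) (t j)) j := by
      intro j; by_cases hj : j ∈ B <;> simp [hj]
    simp only [e]
    rw [Finset.prod_piecewise, Finset.univ_inter]
  have hint : ∀ B : Finset (Fin n), Integrable (fun t : Fin n → ℝ =>
      ∏ j, B.piecewise δ (fun j => halfPlaneFactor (z' j)) j (t j)) μ := fun B =>
    integrable_prod hμ fun j => by
      by_cases hj : j ∈ B
      · simpa [hj] using hδd j
      · simpa [hj] using cauchyDominated_halfPlaneFactor (hz'c j)
  rw [integral_congr_ae (.of_forall hexp), integral_finsetSum _ fun B _ => hint B,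
    Finset.sum_eq_single ∅]
  · simp only [Finset.piecewise_empty, hz']
  · intro B _ hB
    by_cases hBlow : ∃ k ∈ B, (z k).im < 0
    · obtain ⟨k, hkB, hk⟩ := hBlow
      have h0 : ∀ t : Fin n → ℝ,
          ∏ j, B.piecewise δ (fun j => halfPlaneFactor (z' j)) j (t j) = 0 := fun t =>
        Finset.prod_eq_zero (Finset.mem_univ k) (by simp [hkB, hδ, hz', hk])
      simp [h0]
    push Not at hBlow
    -- the index is `-1` on `B`, `1` in the lower half-plane, and `0` elsewhere
    set ρ : Fin n → SignType := fun j =>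
      if j ∈ B then -1 else if (z j).im < 0 then 1 else 0 with hρ
    set y : Fin n → ℂ := fun j => if (z j).im < 0 then conj (z j) else z j with hy
    have hyU : y ∈ polyUpper n := fun j => by
      by_cases h : (z j).im < 0
      · simp [hy, h]
      · simpa [hy, h] using lt_of_le_of_ne (not_lt.1 h) (hz j).symm
    set e : Fin n → ℂ := fun j => if (z j).im < 0 then -1 else 1 with he
    have hfac : ∀ j (s : ℝ), B.piecewise δ (fun j => halfPlaneFactor (z' j)) j s =
        e j * nFactor (ρ j) (y j) s := by
      intro j s
      by_cases hj : j ∈ B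
      · have hl : ¬ (z j).im < 0 := not_lt.2 (hBlow j hj)
        have : ρ j = SignType.neg := by simp only [hρ, hj, if_true]; rfl
        rw [this, nFactor_neg]
        simp [hj, hδ, hz', hy, he, hl, halfPlaneFactor_I]
      · by_cases hl : (z j).im < 0
        · have : ρ j = SignType.pos := by simp only [hρ, hj, hl, if_true, if_false]; rfl
          rw [this, nFactor_pos]
          simp [hj, hz', hy, he, hl]
        · have : ρ j = SignType.zero := by simp only [hρ, hj, hl, if_false]; rfl
          rw [this, nFactor_zero]
          simp [hj, hz', he, hl, halfPlaneFactor_I]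
    simp only [hfac, Finset.prod_mul_distrib]
    rw [integral_const_mul]
    obtain ⟨b, hb⟩ := Finset.nonempty_iff_ne_empty.2 hB
    obtain ⟨k, hk⟩ := hlow
    have hkB : k ∉ B := fun h => absurd hk (not_lt.2 (hBlow k h))
    have h := nIntegral_eq_zero hμ hN (ρ₀ := ρ) ⟨b, by simp [hρ, hb]⟩
      ⟨k, by simp [hρ, hkB, hk]⟩ hyU
    rw [nIntegral] at h
    rw [h, mul_zero]
  · exact fun h => absurd (Finset.mem_univ _) h

lemma integralFormula_zero_eq (hμ : GrowthCondition μ) (a : ℝ) {z : Fin n → ℂ}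
    (hz : z ∈ polyCut n) : integralFormula a (0 : Fin n → ℝ) μ z =
      a + 1 / (Real.pi : ℂ) ^ n * (Complex.I * (2 * ∫ t, ∏ j, halfPlaneFactor (z j) (t j) ∂μ -
        ∫ t, ((∏ l, cauchyWeight (t l) : ℝ) : ℂ) ∂μ)) := by
  simp only [integralFormula, Pi.zero_apply, Complex.ofReal_zero, zero_mul, Finset.sum_const_zero,
    add_zero]
  have hw := integrable_prod_cauchyWeight hμ
  rw [← integral_const_mul 2, ← integral_sub (g := fun t => ((∏ l, cauchyWeight (t l) : ℝ) : ℂ))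
    ((integrable_prod_halfPlaneFactor hμ hz).const_mul 2) hw.ofReal,
    ← integral_const_mul Complex.I]
  simp only [kernel_eq]

lemma variableNonDependence_integralFormula (hμ : GrowthCondition μ) (hN : NevanlinnaCondition μ)
    (a : ℝ) : VariableNonDependence (integralFormula a (0 : Fin n → ℝ) μ) := by
  intro z hz w hw hlow hkeep hup
  have hiff : ∀ j, (w j).im < 0 ↔ (z j).im < 0 := by
    intro j
    rcases lt_or_gt_of_ne (hz j) with h | h
    · rw [hkeep j h]
    · exact ⟨fun h' => absurd (hup j h) (lt_asymm h'), fun h' => absurd h (lt_asymm h')⟩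
  obtain ⟨k, hk⟩ := hlow
  rw [integralFormula_zero_eq hμ a hz, integralFormula_zero_eq hμ a hw,
    integral_prod_halfPlaneFactor_eq hμ hN hz ⟨k, hk⟩,
    integral_prod_halfPlaneFactor_eq hμ hN hw ⟨k, (hiff k).2 hk⟩]
  congr 5
  refine integral_congr_ae (.of_forall fun t => ?_)
  refine Finset.prod_congr rfl fun j _ => ?_
  by_cases hj : (z j).im < 0
  · rw [if_pos hj, if_pos ((hiff j).2 hj), hkeep j hj]
  · rw [if_neg hj, if_neg (fun h => hj ((hiff j).1 h))]

/-! ### Growth along the imaginary axes -/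

lemma tendsto_linear_div (b : Fin n → ℝ) (j : Fin n) :
    Tendsto (fun y : ℝ => (∑ k, (b k : ℂ) *
      Function.update (fun _ : Fin n => Complex.I) j (y * Complex.I) k) / (y * Complex.I))
      atTop (𝓝 (b j)) := by
  have h := (tendsto_const_div_mul_I (∑ k ∈ Finset.univ.erase j, (b k : ℂ) * Complex.I)).const_add
    (b j : ℂ)
  rw [add_zero] at h
  refine h.congr' ?_
  filter_upwards [eventually_gt_atTop 0] with y hy
  have : (y : ℂ) ≠ 0 := Complex.ofReal_ne_zero.2 hy.ne'
  have := Complex.I_ne_zero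
  rw [← Finset.add_sum_erase _ _ (Finset.mem_univ j), Function.update_self, add_div]
  congr 1
  · field_simp
  · congr 1
    refine Finset.sum_congr rfl fun k hk => ?_
    rw [Function.update_of_ne (Finset.ne_of_mem_erase hk)]

lemma mul_I_im_ne_zero {y : ℝ} (hy : 1 ≤ y) : ((y : ℂ) * Complex.I).im ≠ 0 := by
  simp; linarith

lemma norm_factorRatio_mul_I_div_le {y : ℝ} (hy : 1 ≤ y) (t : ℝ) :
    ‖factorRatio (y * Complex.I) t / (y * Complex.I)‖ ≤ 2 := by
  have hy0 : 0 < y := by linarith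
  have h := norm_factorRatio_le (mul_I_im_ne_zero hy) t
  have e1 : ‖(y : ℂ) * Complex.I + Complex.I‖ = y + 1 := by
    rw [show (y : ℂ) * Complex.I + Complex.I = ((y + 1 : ℝ) : ℂ) * Complex.I by push_cast; ring,
      norm_mul, Complex.norm_real, Complex.norm_I, Real.norm_of_nonneg (by linarith), mul_one]
  have e2 : ‖(y : ℂ) * Complex.I - Complex.I‖ = y - 1 := by
    rw [show (y : ℂ) * Complex.I - Complex.I = ((y - 1 : ℝ) : ℂ) * Complex.I by push_cast; ring,
      norm_mul, Complex.norm_real, Complex.norm_I, Real.norm_of_nonneg (by linarith), mul_one]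
  have e3 : |((y : ℂ) * Complex.I).im| = y := by simp [abs_of_pos hy0]
  rw [e1, e2, e3] at h
  rw [norm_div, norm_mul, Complex.norm_real, Complex.norm_I, mul_one, Real.norm_of_nonneg hy0.le,
    div_le_iff₀ hy0]
  refine h.trans ?_
  have : 1 + (y - 1) / y ≤ 2 := by
    have : (y - 1) / y ≤ 1 := (div_le_one hy0).2 (by linarith)
    linarith
  nlinarith

lemma tendsto_factorRatio_mul_I_div (t : ℝ) :
    Tendsto (fun y : ℝ => factorRatio (y * Complex.I) t / (y * Complex.I)) atTop (𝓝 0) := by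
  have hlim : Tendsto (fun y : ℝ => ‖(t : ℂ) - Complex.I‖ / y) atTop (𝓝 0) :=
    tendsto_const_nhds.div_atTop tendsto_id
  refine squeeze_zero_norm' ?_ hlim
  filter_upwards [eventually_ge_atTop 1] with y hy
  have hy0 : 0 < y := by linarith
  have h1 := ofReal_sub_ne_zero (mul_I_im_ne_zero hy) t
  have h2 := abs_im_le_norm_ofReal_sub (y * Complex.I) t
  rw [show ((y : ℂ) * Complex.I).im = y by simp, abs_of_pos hy0] at h2
  have hyc : (y : ℂ) ≠ 0 := Complex.ofReal_ne_zero.2 hy0.ne'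
  have hI := Complex.I_ne_zero
  have e : factorRatio (y * Complex.I) t =
      (((y + 1) / 2 : ℝ) : ℂ) * ((t - Complex.I) / (t - y * Complex.I)) := by
    rw [factorRatio]
    push_cast
    field_simp
    ring
  rw [e, norm_div, norm_mul, norm_mul, norm_div, Complex.norm_real, Complex.norm_real,
    Complex.norm_I, mul_one, Real.norm_of_nonneg hy0.le, Real.norm_of_nonneg (by linarith)]
  gcongr
  have h3 : ‖(t : ℂ) - Complex.I‖ / ‖(t : ℂ) - y * Complex.I‖ ≤ ‖(t : ℂ) - Complex.I‖ / y := by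
    gcongr
  calc _ ≤ (y + 1) / 2 * (‖(t : ℂ) - Complex.I‖ / y) := by gcongr
    _ = (y + 1) / (2 * y) * ‖(t : ℂ) - Complex.I‖ := by field_simp
    _ ≤ 1 * ‖(t : ℂ) - Complex.I‖ := by
      refine mul_le_mul_of_nonneg_right ?_ (norm_nonneg _)
      rw [div_le_one (by linarith)]
      linarith
    _ = _ := one_mul _

/-- The integral term of the representation grows sublinearly along the imaginary axis in every
variable, by dominated convergence. -/
lemma tendsto_integralFormula_div (hμ : GrowthCondition μ) (a : ℝ) (j : Fin n) :
    Tendsto (fun y : ℝ => integralFormula a (0 : Fin n → ℝ) μ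
      (Function.update (fun _ => Complex.I) j (y * Complex.I)) / (y * Complex.I)) atTop (𝓝 0) := by
  set W : (Fin n → ℝ) → ℂ := fun t => ((∏ l, cauchyWeight (t l) : ℝ) : ℂ) with hW
  have hWc : Continuous W := Complex.continuous_ofReal.comp continuous_prod_cauchyWeight
  have hWi : Integrable W μ := (integrable_prod_cauchyWeight hμ).ofReal
  have hmem : ∀ y : ℝ, 1 ≤ y →
      Function.update (fun _ => Complex.I) j (y * Complex.I) ∈ polyCut n := fun y hy =>
    polyUpper_subset_polyCut (update_mem_polyUpper I_mem_polyUpper j (by simp; linarith))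
  have hprod : ∀ y : ℝ, 1 ≤ y → ∀ t : Fin n → ℝ, ∏ k, halfPlaneFactor
      (Function.update (fun _ => Complex.I) j (y * Complex.I) k) (t k) =
      W t * factorRatio (y * Complex.I) (t j) := by
    intro y hy t
    simp only [hW, Complex.ofReal_prod]
    rw [← Finset.mul_prod_erase _ _ (Finset.mem_univ j),
      ← Finset.mul_prod_erase _ (fun l => (cauchyWeight (t l) : ℂ)) (Finset.mem_univ j),
      Function.update_self, halfPlaneFactor_eq (mul_I_im_ne_zero hy)]
    rw [Finset.prod_congr rfl fun k hk => by
      rw [Function.update_of_ne (Finset.ne_of_mem_erase hk), halfPlaneFactor_I]]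
    ring
  have hdom : Tendsto (fun y : ℝ => ∫ t, W t * (factorRatio (y * Complex.I) (t j) /
      (y * Complex.I)) ∂μ) atTop (𝓝 (∫ t, W t * 0 ∂μ)) := by
    refine tendsto_integral_filter_of_dominated_convergence (fun t => ‖W t‖ * 2) ?_ ?_
      (hWi.norm.mul_const 2) (.of_forall fun t => (tendsto_factorRatio_mul_I_div (t j)).const_mul _)
    · filter_upwards [eventually_ge_atTop 1] with y hy
      exact (hWc.mul (((continuous_factorRatio (mul_I_im_ne_zero hy)).comp
        (continuous_apply j)).div_const _)).aestronglyMeasurable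
    · filter_upwards [eventually_ge_atTop 1] with y hy
      refine .of_forall fun t => ?_
      rw [norm_mul]
      exact mul_le_mul_of_nonneg_left (norm_factorRatio_mul_I_div_le hy (t j)) (norm_nonneg _)
  simp only [mul_zero, integral_zero] at hdom
  have h := (hdom.const_mul (1 / (Real.pi : ℂ) ^ n * (Complex.I * 2))).add
    (tendsto_const_div_mul_I (a - 1 / (Real.pi : ℂ) ^ n * (Complex.I * ∫ t, W t ∂μ)))
  rw [mul_zero, add_zero] at h
  refine h.congr' ?_
  filter_upwards [eventually_ge_atTop 1] with y hy
  rw [integralFormula_zero_eq hμ a (hmem y hy)]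
  simp only [hprod y hy, ← mul_div_assoc, integral_div]
  ring

lemma integralFormula_eq_add (a : ℝ) (b : Fin n → ℝ) (z : Fin n → ℂ) :
    integralFormula a b μ z = ∑ j, (b j : ℂ) * z j + integralFormula a 0 μ z := by
  simp only [integralFormula, Pi.zero_apply, Complex.ofReal_zero, zero_mul, Finset.sum_const_zero]
  ring

/-- The coefficients of the linear part are the limits along the imaginary axes. -/
lemma tendsto_integralFormula_div_eq (hμ : GrowthCondition μ) (a : ℝ) (b : Fin n → ℝ) (j : Fin n) :
    Tendsto (fun y : ℝ => integralFormula a b μ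
      (Function.update (fun _ => Complex.I) j (y * Complex.I)) / (y * Complex.I))
      atTop (𝓝 (b j)) := by
  have h := (tendsto_linear_div b j).add (tendsto_integralFormula_div hμ a j)
  rw [add_zero] at h
  refine h.congr fun y => ?_
  rw [integralFormula_eq_add a b, add_div]

lemma tendsto_im_div {φ : ℝ → ℂ}
    (h : Tendsto (fun y : ℝ => φ y / (y * Complex.I)) atTop (𝓝 0)) :
    Tendsto (fun y : ℝ => (φ y).im / y) atTop (𝓝 0) := by
  have h1 := (Complex.continuous_re.tendsto 0).comp h
  rw [Complex.zero_re] at h1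
  refine h1.congr fun y => ?_
  have : φ y / (y * Complex.I) = -(φ y * Complex.I) / y := by
    rw [div_mul_eq_div_div_swap, Complex.div_I]
  rw [Function.comp_apply, this, Complex.div_ofReal_re]
  simp

end HerglotzNevanlinna

end

theorem corollary3p4 (n : ℕ) (hn : 1 ≤ n) (f : (Fin n → ℂ) → ℂ) (d : Fin n → ℝ)
    (hf : DifferentiableOn ℂ f (HerglotzNevanlinna.polyCut n))
    (hd : ∀ j, 0 ≤ d j)
    (hupper : ∀ j, ∀ z ∈ HerglotzNevanlinna.polyCut n,
      HerglotzNevanlinna.TendstoUpper (fun w => f (Function.update z j w) / w) (d j : ℂ))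
    (hlower : ∀ j, ∀ z ∈ HerglotzNevanlinna.polyCut n,
      HerglotzNevanlinna.TendstoLower (fun w => f (Function.update z j w) / w) (d j : ℂ)) :
    (∃ h : (Fin n → ℂ) → ℂ, HerglotzNevanlinna.IsHerglotzNevanlinna h ∧
        HerglotzNevanlinna.IsSymmetricExtension h f) ↔
      (∀ z ∈ HerglotzNevanlinna.polyUpper n, 0 ≤ (f z).im) ∧
        HerglotzNevanlinna.SymmetryFormula (fun z => f z - ∑ j, (d j : ℂ) * z j) ∧
        HerglotzNevanlinna.VariableNonDependence (fun z => f z - ∑ j, (d j : ℂ) * z j) := by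
  have hlim : ∀ j, ∀ z ∈ HerglotzNevanlinna.polyUpper n, Filter.Tendsto
      (fun y : ℝ => f (Function.update z j (y * Complex.I)) / (y * Complex.I)) Filter.atTop
      (𝓝 (d j : ℂ)) := fun j z hz =>
    (hupper j z (HerglotzNevanlinna.polyUpper_subset_polyCut hz)).tendsto_mul_I
  have hfU := hf.mono HerglotzNevanlinna.polyUpper_subset_polyCut
  constructor
  · rintro ⟨h, ⟨-, him⟩, a, b, μ, ⟨-, hμ, hN, hh⟩, hfe⟩
    -- the coefficients `b` and `d` agree, being limits of the same quotients
    have hbd : b = d := by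
      funext j
      refine Complex.ofReal_injective (tendsto_nhds_unique
        (HerglotzNevanlinna.tendsto_integralFormula_div_eq hμ a b j)
        ((hlim j _ HerglotzNevanlinna.I_mem_polyUpper).congr' ?_))
      filter_upwards [Filter.eventually_gt_atTop 0] with y hy
      rw [hfe _ (HerglotzNevanlinna.polyUpper_subset_polyCut
        (HerglotzNevanlinna.update_mem_polyUpper HerglotzNevanlinna.I_mem_polyUpper j
          (by simpa using hy)))]
    subst hbd
    have hg : ∀ z ∈ HerglotzNevanlinna.polyCut n, f z - ∑ j, (b j : ℂ) * z j =
        HerglotzNevanlinna.integralFormula a 0 μ z := fun z hz => by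
      rw [hfe z hz, HerglotzNevanlinna.integralFormula_eq_add a b, add_sub_cancel_left]
    refine ⟨fun z hz => ?_, fun z hz => ?_, fun z hz w hw hlow hkeep hup => ?_⟩
    · rw [hfe z (HerglotzNevanlinna.polyUpper_subset_polyCut hz), ← hh z hz]
      exact him z hz
    · simp only [hg z hz]
      rw [HerglotzNevanlinna.symmetryFormula_integralFormula hn hμ a z hz]
      refine Finset.sum_congr rfl fun B _ => ?_
      rw [hg _ (HerglotzNevanlinna.selConj_mem_polyCut hz B)]
    · simp only [hg z hz, hg w hw]
      exact HerglotzNevanlinna.variableNonDependence_integralFormula hμ hN a z hz w hw hlow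
        hkeep hup
  · rintro ⟨him, hs, hv⟩
    set g : (Fin n → ℂ) → ℂ := fun z => f z - ∑ j, (d j : ℂ) * z j with hg
    have hgd : DifferentiableOn ℂ g (HerglotzNevanlinna.polyUpper n) :=
      hfU.sub (by fun_prop)
    obtain ⟨a, μ, hμ, hN, hrep⟩ := HerglotzNevanlinna.exists_represents hgd
      (HerglotzNevanlinna.im_sub_linear_nonneg hfU hd hlim him Finset.univ) fun j => by
        refine HerglotzNevanlinna.tendsto_im_div ?_
        have h := (hlim j _ HerglotzNevanlinna.I_mem_polyUpper).sub
          (HerglotzNevanlinna.tendsto_linear_div d j)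
        rw [sub_self] at h
        exact h.congr fun y => (sub_div _ _ _).symm
    -- `g` and its integral formula have the same symmetries and agree on the poly-upper half-plane
    have hzero := HerglotzNevanlinna.eq_zero_of_symmetry
      (D := fun z => g z - HerglotzNevanlinna.integralFormula a 0 μ z)
      (fun z hz => by
        simp only [map_sub, mul_sub, Finset.sum_sub_distrib]
        rw [← hs z hz, ← HerglotzNevanlinna.symmetryFormula_integralFormula hn hμ a z hz])
      (fun z hz w hw hlow hkeep hup => by
        simp only
        rw [hv z hz w hw hlow hkeep hup,
          HerglotzNevanlinna.variableNonDependence_integralFormula hμ hN a z hz w hw hlow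
            hkeep hup])
      (fun z hz => sub_eq_zero.2 (hrep z hz))
    have hfe : ∀ z ∈ HerglotzNevanlinna.polyCut n,
        f z = HerglotzNevanlinna.integralFormula a d μ z := fun z hz => by
      rw [HerglotzNevanlinna.integralFormula_eq_add, ← sub_eq_zero.1 (hzero z hz)]
      simp only [hg, add_sub_cancel]
    exact ⟨f, ⟨hfU, him⟩, a, d, μ,
      ⟨hd, hμ, hN, fun z hz => hfe z (HerglotzNevanlinna.polyUpper_subset_polyCut hz)⟩, hfe⟩
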